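/- An instance of $(2,4)$-UUSC consists of $n$ base elements and a finite collection $\mathcal C$ of subsets of them, each of size between $2$ and $4$, that covers all base elements and contains every subset of size $2$ (so $n\neq 1$). A cover is a subcollection of $\mathcal C$ whose union is the whole ground set, and $OPT$ denotes the minimum number of sets in a cover. Algorithm $A1$ with accuracy $\varepsilon>0$ works as follows. At any moment, an $i$-set is a set of $i$ still uncovered elements that is contained in some member of $\mathcal C$. For $i=4$ and then $i=3$ (the packing phases), select a collection of pairwise disjoint $i$-sets that is maximal under inclusion and whose cardinality is at least $\frac{2-\varepsilon}{i}$ times the maximum cardinality of a collection of pairwise disjoint $i$-sets; the elements of the selected sets become covered. Finally partition the remaining uncovered elements into sets of size $2$ and at most one singleton. Let $D$ be the collection of all selected sets. The algorithm returns the collection $APX\subseteq\mathcal C$ obtained by replacing each member of $D$ by a member of $\mathcal C$ containing it. Then $A1$ is an asymptotic $(1.5+\varepsilon)$-approximation algorithm for $(2,4)$-UUSC. That is, for every $\varepsilon>0$: 1. For every instance and every possible execution of $A1$ with accuracy $\varepsilon$, the returned collection $APX$ is a cover and $$|APX|\le |D|\le \left(\tfrac32+\varepsilon\right) OPT+1 .$$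 2. $A1$ can be carried out in polynomial time: there are a number $t$ and a polynomial $q$, depending only on $\varepsilon$, such that if in each packing phase $i$ the collection is computed by local search (start with the empty collection of $i$-sets; as long as possible, insert at most $t$ pairwise disjoint $i$-sets and remove the selected $i$-sets that meet them so that the number of selected sets increases), then on every instance, given as an explicit list of its sets, the resulting program performs at most $q(N)$ elementary steps, where $N$ is $n$ plus the sum of $|S|+1$ over the listed sets $S$; its computation is a legal execution of $A1$ with accuracy $\varepsilon$, and it returns a cover, as a list of $|D|$ sets, with at most $(\tfrac32+\varepsilon)\,OPT+1$ entries. -/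

import Mathlib

/-- An instance of the `(p,k)`-uniform unweighted set cover problem on `n` base elements: a finite
collection of sets of size between `p` and `k` which covers the base elements and contains all
sets of size `p`.  (If `1 ≤ p ≤ n`, the field `covers` follows from `all_small`.) -/
structure UUSC (p k n : ℕ) where
  sets : Finset (Finset (Fin n))
  card_ge : ∀ S ∈ sets, p ≤ S.card
  card_le : ∀ S ∈ sets, S.card ≤ k
  all_small : ∀ S : Finset (Fin n), S.card = p → S ∈ sets
  covers : ∀ x : Fin n, ∃ S ∈ sets, x ∈ S

namespace UUSC

variable {p k n : ℕ}

/-- A feasible solution: a subcollection of the input that covers all base elements. -/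
def IsCover (I : UUSC p k n) (F : Finset (Finset (Fin n))) : Prop :=
  F ⊆ I.sets ∧ ∀ x : Fin n, ∃ S ∈ F, x ∈ S

/-- The minimum cardinality of a cover; the set is nonempty, as the whole input is a cover. -/
noncomputable def opt (I : UUSC p k n) : ℕ :=
  sInf {m : ℕ | ∃ F : Finset (Finset (Fin n)), I.IsCover F ∧ F.card = m}

/-- `S` is an `i`-set at the moment when `V` is the set of uncovered elements: it has `i` elements,
all of them uncovered, and it belongs to the subset closure of the input. -/
def IsFreeSet (I : UUSC p k n) (V : Finset (Fin n)) (i : ℕ) (S : Finset (Fin n)) : Prop :=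
  S ⊆ V ∧ S.card = i ∧ ∃ T ∈ I.sets, S ⊆ T

/-- `P` is a collection of disjoint `i`-sets. -/
def IsPacking (I : UUSC p k n) (V : Finset (Fin n)) (i : ℕ) (P : Finset (Finset (Fin n))) : Prop :=
  (∀ S ∈ P, I.IsFreeSet V i S) ∧ (P : Set (Finset (Fin n))).PairwiseDisjoint id

/-- A legal outcome of packing phase `i`: a maximal collection of disjoint `i`-sets whose
cardinality is at least `(2 - ε) / i` times that of every collection of disjoint `i`-sets. -/
def IsPhaseOutcome (I : UUSC p k n) (ε : ℝ) (V : Finset (Fin n)) (i : ℕ)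
    (P : Finset (Finset (Fin n))) : Prop :=
  I.IsPacking V i P ∧
  (∀ S, I.IsFreeSet V i S → ∃ T ∈ P, ¬ Disjoint S T) ∧
  ∀ Q, I.IsPacking V i Q → (2 - ε) / i * (Q.card : ℝ) ≤ (P.card : ℝ)

/-- A legal outcome of phase `p`: the uncovered elements are partitioned into sets of size `p` and
at most one further set, of size less than `p`. -/
def IsFinalOutcome (p : ℕ) (V : Finset (Fin n)) (Q : Finset (Finset (Fin n))) : Prop :=
  (Q : Set (Finset (Fin n))).PairwiseDisjoint id ∧ Q.sup id = V ∧
  (∀ S ∈ Q, S.Nonempty ∧ S.card ≤ p) ∧ (Q.filter fun S => S.card < p).card ≤ 1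

/-- `I.Run ε i V D`: starting with phase `i` and uncovered elements `V`, algorithm A1 (with any
packing subroutine of guarantee `(2 - ε) / i` in phase `i`) may select the collection `D`. -/
inductive Run (I : UUSC p k n) (ε : ℝ) :
    ℕ → Finset (Fin n) → Finset (Finset (Fin n)) → Prop
  | final (V : Finset (Fin n)) (Q : Finset (Finset (Fin n))) (hQ : IsFinalOutcome p V Q) :
      Run I ε p V Q
  | phase (i : ℕ) (V : Finset (Fin n)) (P R : Finset (Finset (Fin n))) (hi : p < i)
      (hP : I.IsPhaseOutcome ε V i P) (hR : Run I ε (i - 1) (V \ P.sup id) R) :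
      Run I ε i V (P ∪ R)

/-- Algorithm A1 may select the disjoint collection `D` (of members of the subset closure of the
input) and return the cover `APX`, in which every member of `D` is represented by an
input set that contains it. -/
def IsA1Output (I : UUSC p k n) (ε : ℝ) (D APX : Finset (Finset (Fin n))) : Prop :=
  I.Run ε k Finset.univ D ∧
  ∃ f : Finset (Fin n) → Finset (Fin n),
    (∀ S ∈ D, f S ∈ I.sets ∧ S ⊆ f S) ∧ APX = D.image f

end UUSC

/-- The result of a computation together with the number of steps that it took. -/
structure Timed (β : Type) where
  val : β
  steps : ℕ

namespace Timed

instance : Monad Timed where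
  pure a := ⟨a, 0⟩
  bind x f := ⟨(f x.val).val, x.steps + (f x.val).steps⟩

/-- Spend one step. -/
def tick : Timed Unit := ⟨(), 1⟩

/-! In the programs below every call of a function, recursive calls included, is charged one step.
Apart from calls, a function body does a bounded number of operations of constant time: taking a
list apart, building a list cell, comparing two base elements, computing with two counters. -/

section Programs

variable {α β : Type} [DecidableEq α]

def appendT : List β → List β → Timed (List β)
  | [], ys => do
      tick
      return ys
  | x :: xs, ys => do
      tick
      let r ← appendT xs ys
      return x :: r

def lengthT : List β → Timed ℕ
  | [] => do
      tick
      return 0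
  | _ :: xs => do
      tick
      let r ← lengthT xs
      return r + 1

def flattenT : List (List β) → Timed (List β)
  | [] => do
      tick
      return []
  | x :: xs => do
      tick
      let r ← flattenT xs
      appendT x r

/-- Put `x` in front of every list. -/
def consAllT (x : β) : List (List β) → Timed (List (List β))
  | [] => do
      tick
      return []
  | l :: ls => do
      tick
      let r ← consAllT x ls
      return (x :: l) :: r

/-- All sublists of length `i`. -/
def sublistsT : ℕ → List β → Timed (List (List β))
  | 0, _ => do
      tick
      return [[]]
  | _ + 1, [] => do
      tick
      return []
  | i + 1, x :: xs => do
      tick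
      let a ← sublistsT i xs
      let b ← consAllT x a
      let c ← sublistsT (i + 1) xs
      appendT b c

/-- All sublists of length at most `t`. -/
def sublistsUpToT : ℕ → List β → Timed (List (List β))
  | 0, l => do
      tick
      sublistsT 0 l
  | t + 1, l => do
      tick
      let a ← sublistsT (t + 1) l
      let b ← sublistsUpToT t l
      appendT a b

def memT (x : α) : List α → Timed Bool
  | [] => do
      tick
      return false
  | y :: ys => do
      tick
      if x = y then return true else memT x ys

def subsetT : List α → List α → Timed Bool
  | [], _ => do
      tick
      return true
  | x :: xs, ys => do
      tick
      let b ← memT x ys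
      if b then subsetT xs ys else return false

def disjointT : List α → List α → Timed Bool
  | [], _ => do
      tick
      return true
  | x :: xs, ys => do
      tick
      let b ← memT x ys
      if b then return false else disjointT xs ys

def interT : List α → List α → Timed (List α)
  | [], _ => do
      tick
      return []
  | x :: xs, ys => do
      tick
      let b ← memT x ys
      let r ← interT xs ys
      if b then return x :: r else return r

def diffT : List α → List α → Timed (List α)
  | [], _ => do
      tick
      return []
  | x :: xs, ys => do
      tick
      let b ← memT x ys
      let r ← diffT xs ys
      if b then return r else return x :: r

/-- Is `S` disjoint from all the given sets? -/
def disjointAllT (S : List α) : List (List α) → Timed Bool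
  | [] => do
      tick
      return true
  | T :: Ts => do
      tick
      let b ← disjointT S T
      if b then disjointAllT S Ts else return false

def pairwiseDisjointT : List (List α) → Timed Bool
  | [] => do
      tick
      return true
  | S :: Ss => do
      tick
      let b ← disjointAllT S Ss
      if b then pairwiseDisjointT Ss else return false

/-- The members of the first family that are disjoint from all members of `Q`. -/
def keepT (Q : List (List α)) : List (List α) → Timed (List (List α))
  | [] => do
      tick
      return []
  | S :: Ss => do
      tick
      let b ← disjointAllT S Q
      let r ← keepT Q Ss
      if b then return S :: r else return r

/-- All `i`-sets (with uncovered elements `V` and input collection given by the third argument). -/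
def freeSetsT (V : List α) (i : ℕ) : List (List α) → Timed (List (List α))
  | [] => do
      tick
      return []
  | S :: Ss => do
      tick
      let U ← interT S V
      let a ← sublistsT i U
      let r ← freeSetsT V i Ss
      appendT a r

/-- Search through a list of families `Q` for one that improves the packing `P`: `Q` is pairwise
disjoint, and inserting `Q` into `P` and removing the members of `P` which meet a member of `Q`
yields a packing with more sets than `P`. -/
def improveT (P : List (List α)) : List (List (List α)) → Timed (Option (List (List α)))
  | [] => do
      tick
      return none
  | Q :: Qs => do
      tick
      let b ← pairwiseDisjointT Q
      if b then
        let K ← keepT Q P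
        let P' ← appendT Q K
        let a ← lengthT P
        let a' ← lengthT P'
        if a < a' then return some P' else improveT P Qs
      else improveT P Qs

/-- Local search for set packing: while inserting some family from `Qs` improves
the current packing, replace it by the improved one (at most as often as the first argument says). -/
def localSearchT (Qs : List (List (List α))) : ℕ → List (List α) → Timed (List (List α))
  | 0, P => do
      tick
      return P
  | m + 1, P => do
      tick
      let r ← improveT P Qs
      match r with
      | none => return P
      | some P' => localSearchT Qs m P'

/-- Packing phase `i` by local search in which at most `t` sets are inserted at a time. Each
improvement adds a set to the packing, so that `|V|` rounds suffice. -/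
def packT (t : ℕ) (L : List (List α)) (V : List α) (i : ℕ) : Timed (List (List α)) := do
  tick
  let C ← freeSetsT V i L
  let Qs ← sublistsUpToT t C
  let m ← lengthT V
  localSearchT Qs m []

/-- Cut a list into blocks of size `p` and possibly one smaller block; `B` is the current block and
`r` the number of elements that it still lacks. -/
def blocksT (p : ℕ) : List α → ℕ → List α → Timed (List (List α))
  | [], _, [] => do
      tick
      return []
  | y :: B, _, [] => do
      tick
      return [y :: B]
  | B, 0, x :: xs => do
      tick
      let R ← blocksT p [x] (p - 1) xs
      return B :: R
  | B, r + 1, x :: xs => do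
      tick
      blocksT p (x :: B) r xs

/-- Packing phases `p + d, …, p + 1`, followed by phase `p`. -/
def phasesT (p t : ℕ) (L : List (List α)) : ℕ → List α → Timed (List (List α))
  | 0, V => do
      tick
      blocksT p [] p V
  | d + 1, V => do
      tick
      let P ← packT t L V (p + d + 1)
      let U ← flattenT P
      let W ← diffT V U
      let R ← phasesT p t L d W
      appendT P R

/-- The first set of the family that contains `S`. -/
def containingT (S : List α) : List (List α) → Timed (List α)
  | [] => do
      tick
      return S
  | T :: Ts => do
      tick
      let b ← subsetT S T
      if b then return T else containingT S Ts

/-- Replace every selected set by a set of the family `L` that contains it. -/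
def liftT (L : List (List α)) : List (List α) → Timed (List (List α))
  | [] => do
      tick
      return []
  | S :: Ss => do
      tick
      let T ← containingT S L
      let R ← liftT L Ss
      return T :: R

end Programs

/-- The list of all base elements, at a cost of `n + 1` steps. -/
def groundT (n : ℕ) : Timed (List (Fin n)) := ⟨List.finRange n, n + 1⟩

/-- Algorithm A1 for `(p,k)`-UUSC whose packing subroutine is local search with parameter `t`. The
input is the number `n` of base elements and a list of the input sets. -/
def algorithmA1 (p k t n : ℕ) (L : List (List (Fin n))) : Timed (List (List (Fin n))) := do
  tick
  let V ← groundT n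
  let D ← phasesT p t L (k - p) V
  liftT L D

end Timed

/-- The collection of finite sets that a list of lists represents. -/
def familyOf {n : ℕ} (L : List (List (Fin n))) : Finset (Finset (Fin n)) :=
  (L.map List.toFinset).toFinset

/-- `L` is an explicit representation of the input collection of `I`. -/
def UUSC.IsEncodedBy {p k n : ℕ} (I : UUSC p k n) (L : List (List (Fin n))) : Prop :=
  (∀ S ∈ L, S.Nodup) ∧ familyOf L = I.sets

/-- The length of the explicit representation of an instance. -/
def inputSize (n : ℕ) (L : List (List (Fin n))) : ℕ :=
  n + (L.map fun S => S.length + 1).sum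

/-! The ratio comes from phase 4 and a count of elements. Assign every element to one set of an
optimal cover. The sets that receive four elements yield a packing `O` of 4-sets, and every other
set receives at most three, so `n ≤ 3 * OPT + |O|` (`UUSC.exists_isPacking_univ`). After phase 4 has
selected `P`, all later sets are disjoint and, with at most one exception, have at least two
elements, so there are at most `(n - 4|P| + 1) / 2` of them. Hence `2|D| ≤ 3 * OPT + |O| - 2|P| +
1`, and the guarantee `|P| ≥ (2 - ε)/4 * |O|` turns this into the claimed bound
(`UUSC.Run.card_le_opt`).

That local search achieves the guarantee is the theorem of Hurkens and Schrijver. Join each set of a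
competing packing `O` to the selected sets that it meets. If no insertion of at most `t` sets is an
improvement, every `X ⊆ O` with `|X| ≤ t` has at least `|X|` neighbours (`UUSC.localHall_packT`). In
such a graph, peel off layers of vertices with at most one neighbour outside the neighbourhood of
the earlier layers. The peeled part `A` satisfies `|A| ≤ |N(A)|` because it is covered by small
tight sets; among `r` consecutive layers one adds at most `|O| / r` vertices, and beyond that layer
every vertex has two fresh neighbours. Counting edges there gives `2|O| ≤ k|P| + 2|O| / r`
(`LocalHall.card_le`).

For the running time, `t` and the set size are constants, so the search runs through polynomially
many families in each round, and `|V|` rounds suffice. The `_val` lemmas say what the programs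
compute, the `_steps` lemmas what they cost. -/

/-! ### Local Hall conditions and the Hurkens–Schrijver bound -/

section LocalHall

variable {α β : Type*} [DecidableEq α] [DecidableEq β]

/-- The neighbourhood map `N` satisfies Hall's condition on all subsets of `O` of size at most `t`. -/
def LocalHall (N : α → Finset β) (O : Finset α) (t : ℕ) : Prop :=
  ∀ X ⊆ O, X.card ≤ t → X.card ≤ (X.biUnion N).card

/-- If small tight sets cover `A`, then every small set of neighbours of `A` is covered by the
neighbourhood of a small tight set. -/
theorem LocalHall.exists_tight_cover {N : α → Finset β} {O A : Finset α} {t c : ℕ}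
    (h : LocalHall N O t) (hAO : A ⊆ O)
    (hA : ∀ a ∈ A, ∃ T ⊆ A, a ∈ T ∧ T.card ≤ c ∧ (T.biUnion N).card ≤ T.card)
    (Z : Finset β) (hZ : Z ⊆ A.biUnion N) (ht : Z.card * c ≤ t) :
    ∃ U ⊆ A, U.card ≤ Z.card * c ∧ (U.biUnion N).card ≤ U.card ∧ Z ⊆ U.biUnion N := by
  induction Z using Finset.induction_on with
  | empty => exact ⟨∅, by simp, by simp, by simp, by simp⟩
  | insert p Z hp ih =>
    rw [Finset.card_insert_of_notMem hp] at ht ⊢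
    obtain ⟨U, hU, hUc, hUt, hUZ⟩ := ih (fun x hx => hZ (Finset.mem_insert_of_mem hx))
      (le_trans (Nat.mul_le_mul_right c (Nat.le_succ _)) ht)
    obtain ⟨a, ha, hpa⟩ := Finset.mem_biUnion.1 (hZ (Finset.mem_insert_self p Z))
    obtain ⟨T, hT, haT, hTc, hTt⟩ := hA a ha
    have hI := h (U ∩ T) (fun x hx => hAO (hU (Finset.mem_inter.1 hx).1)) (by
      have := Finset.card_le_card (Finset.inter_subset_left (s₁ := U) (s₂ := T))
      nlinarith)
    have hsub : (U ∩ T).biUnion N ⊆ U.biUnion N ∩ T.biUnion N := by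
      intro x hx
      simp only [Finset.mem_biUnion, Finset.mem_inter] at hx ⊢
      obtain ⟨b, ⟨h1, h2⟩, h3⟩ := hx
      exact ⟨⟨b, h1, h3⟩, ⟨b, h2, h3⟩⟩
    -- Submodularity of `X ↦ |N(X)|`: `U` and `T` are tight and `U ∩ T` satisfies Hall's condition,
    -- so `U ∪ T` is tight again.
    have e1 := Finset.card_union_add_card_inter U T
    have e2 := Finset.card_union_add_card_inter (U.biUnion N) (T.biUnion N)
    have e3 := Finset.card_le_card hsub
    refine ⟨U ∪ T, Finset.union_subset hU hT, by nlinarith, ?_, ?_⟩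
    · rw [Finset.union_biUnion]
      omega
    · rw [Finset.union_biUnion]
      refine Finset.insert_subset (Finset.mem_union_right _ ?_)
        (hUZ.trans Finset.subset_union_left)
      exact Finset.mem_biUnion.2 ⟨a, haT, hpa⟩

/-- A small set outside `A` satisfies Hall's condition with respect to the vertices that are not
neighbours of `A`. -/
theorem LocalHall.card_le_card_sdiff {N : α → Finset β} {O A Y : Finset α} {t c : ℕ}
    (h : LocalHall N O t) (hAO : A ⊆ O)
    (hA : ∀ a ∈ A, ∃ T ⊆ A, a ∈ T ∧ T.card ≤ c ∧ (T.biUnion N).card ≤ T.card)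
    (hY : Y ⊆ O) (hYA : Disjoint Y A) (ht : (Y.biUnion N).card * c + Y.card ≤ t) :
    Y.card ≤ (Y.biUnion N \ A.biUnion N).card := by
  have hZ := Finset.card_le_card (Finset.inter_subset_left (s₁ := Y.biUnion N) (s₂ := A.biUnion N))
  have hZc := Nat.mul_le_mul_right c hZ
  obtain ⟨U, hU, hUc, hUt, hUZ⟩ := h.exists_tight_cover hAO hA (Y.biUnion N ∩ A.biUnion N)
    Finset.inter_subset_right (by omega)
  have hd : Disjoint Y U := hYA.mono_right hU
  have hH := h (Y ∪ U) (Finset.union_subset hY (hU.trans hAO)) (by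
    rw [Finset.card_union_of_disjoint hd]; omega)
  rw [Finset.card_union_of_disjoint hd, Finset.union_biUnion] at hH
  -- All neighbours of `Y` inside `N(A)` already belong to `N(U)`; since `|N(U)| ≤ |U|`, the
  -- contribution of `U` cancels from Hall's condition for `Y ∪ U`.
  have hsub : Y.biUnion N ∪ U.biUnion N ⊆ (Y.biUnion N \ A.biUnion N) ∪ U.biUnion N := by
    intro x hx
    by_cases hxA : x ∈ A.biUnion N
    · rcases Finset.mem_union.1 hx with h1 | h1
      · exact Finset.mem_union_right _ (hUZ (Finset.mem_inter.2 ⟨h1, hxA⟩))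
      · exact Finset.mem_union_right _ h1
    · rcases Finset.mem_union.1 hx with h1 | h1
      · exact Finset.mem_union_left _ (Finset.mem_sdiff.2 ⟨h1, hxA⟩)
      · exact Finset.mem_union_right _ h1
  have := Finset.card_le_card hsub
  have := Finset.card_union_le (Y.biUnion N \ A.biUnion N) (U.biUnion N)
  omega

/-- Starting with the empty set, collect repeatedly all vertices that have at most one neighbour
outside the neighbourhood of the vertices collected before. -/
def hallLayers (N : α → Finset β) (O : Finset α) : ℕ → Finset α
  | 0 => ∅
  | j + 1 => O.filter fun o => (N o \ (hallLayers N O j).biUnion N).card ≤ 1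

/-- A bound for the size of the tight sets that cover the `j`-th layer. -/
def tightBound (k : ℕ) : ℕ → ℕ
  | 0 => 0
  | j + 1 => k * tightBound k j + 1

theorem tightBound_mono {k : ℕ} (hk : 0 < k) : Monotone (tightBound k) :=
  monotone_nat_of_le_succ fun j => by
    have : tightBound k j ≤ k * tightBound k j := Nat.le_mul_of_pos_left _ hk
    simp only [tightBound]
    omega

theorem hallLayers_subset {α : Type*} (N : α → Finset β) (O : Finset α) (j : ℕ) : hallLayers N O j ⊆ O := by
  cases j with
  | zero => simp [hallLayers]
  | succ j => exact Finset.filter_subset _ _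

theorem hallLayers_subset_succ {α : Type*} (N : α → Finset β) (O : Finset α) (j : ℕ) :
    hallLayers N O j ⊆ hallLayers N O (j + 1) := by
  induction j with
  | zero => simp [hallLayers]
  | succ j ih =>
    intro o ho
    rw [hallLayers, Finset.mem_filter] at ho
    rw [hallLayers, Finset.mem_filter]
    refine ⟨ho.1, le_trans (Finset.card_le_card ?_) ho.2⟩
    exact Finset.sdiff_subset_sdiff subset_rfl (Finset.biUnion_subset_biUnion_of_subset_left _ ih)

/-- The neighbours of `a` in the previous neighbourhood, at most `k` of them, are covered by a tight
set of size at most `k * tightBound k j`. Adding `a` costs one vertex and brings at most one new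
neighbour, so tightness survives; this is the recursion of `tightBound`. -/
theorem LocalHall.hallLayers_tight {N : α → Finset β} {O : Finset α} {t k : ℕ}
    (h : LocalHall N O t) (hk : ∀ o ∈ O, (N o).card ≤ k) (j : ℕ) (ht : tightBound k j ≤ t)
    (a : α) (ha : a ∈ hallLayers N O j) :
    ∃ T ⊆ hallLayers N O j, a ∈ T ∧ T.card ≤ tightBound k j ∧ (T.biUnion N).card ≤ T.card := by
  induction j generalizing a with
  | zero => simp [hallLayers] at ha
  | succ j ih =>
    have ha' := ha
    rw [hallLayers, Finset.mem_filter] at ha'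
    simp only [tightBound] at ht ⊢
    have hka := hk a ha'.1
    have hcj : tightBound k j ≤ t := by
      rcases Nat.eq_zero_or_pos k with h0 | h0
      · subst h0
        cases j <;> simp_all [tightBound]
      · nlinarith
    have hZ := Finset.card_le_card
      (Finset.inter_subset_left (s₁ := N a) (s₂ := (hallLayers N O j).biUnion N))
    have hZc := Nat.mul_le_mul_right (tightBound k j) (hZ.trans hka)
    obtain ⟨U, hU, hUc, hUt, hUZ⟩ := h.exists_tight_cover (hallLayers_subset N O j) (ih hcj)
      (N a ∩ (hallLayers N O j).biUnion N) Finset.inter_subset_right (by omega)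
    have hU' := hU.trans (hallLayers_subset_succ N O j)
    by_cases haU : a ∈ U
    · exact ⟨U, hU', haU, by omega, hUt⟩
    · refine ⟨insert a U, Finset.insert_subset ha hU', Finset.mem_insert_self _ _, ?_, ?_⟩
      · rw [Finset.card_insert_of_notMem haU]
        omega
      · rw [Finset.card_insert_of_notMem haU, Finset.biUnion_insert]
        have hsub : N a ∪ U.biUnion N ⊆ (N a \ (hallLayers N O j).biUnion N) ∪ U.biUnion N := by
          intro x hx
          by_cases hxA : x ∈ (hallLayers N O j).biUnion N
          · rcases Finset.mem_union.1 hx with h1 | h1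
            · exact Finset.mem_union_right _ (hUZ (Finset.mem_inter.2 ⟨h1, hxA⟩))
            · exact Finset.mem_union_right _ h1
          · rcases Finset.mem_union.1 hx with h1 | h1
            · exact Finset.mem_union_left _ (Finset.mem_sdiff.2 ⟨h1, hxA⟩)
            · exact Finset.mem_union_right _ h1
        have := Finset.card_le_card hsub
        have := Finset.card_union_le (N a \ (hallLayers N O j).biUnion N) (U.biUnion N)
        omega

/-- Hall's condition outside `N(A)` for one and for two new vertices says that each has a private
neighbour there and that no two share it. So a new layer adds at least as many neighbours as
vertices. -/
theorem LocalHall.card_hallLayers_le {N : α → Finset β} {O : Finset α} {t k : ℕ}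
    (h : LocalHall N O t) (hk : ∀ o ∈ O, (N o).card ≤ k) (hk0 : 0 < k) (j : ℕ)
    (ht : 2 * k * tightBound k j + 2 ≤ t) :
    (hallLayers N O j).card ≤ ((hallLayers N O j).biUnion N).card := by
  induction j with
  | zero => simp [hallLayers]
  | succ j ih =>
    have hm := tightBound_mono hk0 (Nat.le_succ j)
    have hkm := Nat.mul_le_mul_left (2 * k) hm
    have hkt : tightBound k j ≤ 2 * k * tightBound k j := Nat.le_mul_of_pos_left _ (by omega)
    have ih := ih (by simp only [Nat.succ_eq_add_one] at hkm; omega)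
    simp only [Nat.succ_eq_add_one] at hkm
    set A := hallLayers N O j with hA
    have hstep : A ⊆ hallLayers N O (j + 1) := hallLayers_subset_succ N O j
    -- Two vertices have at most `2 * k` neighbours, each covered at the price `tightBound k j`;
    -- together with the two vertices this is the size required of `t`.
    have key : ∀ Y ⊆ hallLayers N O (j + 1) \ A, Y.card ≤ 2 →
        Y.card ≤ (Y.biUnion N \ A.biUnion N).card := by
      intro Y hY hY2
      have hYO : Y ⊆ O := fun y hy => hallLayers_subset N O _ (Finset.mem_sdiff.1 (hY hy)).1
      have hYN : (Y.biUnion N).card ≤ Y.card * k :=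
        Finset.card_biUnion_le_card_mul _ _ _ fun y hy => hk y (hYO hy)
      refine h.card_le_card_sdiff (hallLayers_subset N O j)
        (h.hallLayers_tight hk j (by omega)) hYO ?_ ?_
      · exact Finset.disjoint_left.2 fun y hy => (Finset.mem_sdiff.1 (hY hy)).2
      · have : (Y.biUnion N).card * tightBound k j ≤ 2 * k * tightBound k j :=
          Nat.mul_le_mul_right _ (hYN.trans (Nat.mul_le_mul_right k hY2))
        omega
    have hne : ∀ o ∈ hallLayers N O (j + 1) \ A, ∃ p, p ∈ N o \ A.biUnion N := by
      intro o ho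
      have := key {o} (by simpa using ho) (by simp)
      rw [Finset.singleton_biUnion, Finset.card_singleton] at this
      exact Finset.card_pos.1 this
    have hinj : (hallLayers N O (j + 1) \ A).card ≤
        ((hallLayers N O (j + 1)).biUnion N \ A.biUnion N).card := by
      rcases (hallLayers N O (j + 1) \ A).eq_empty_or_nonempty with h0 | ⟨o₀, ho₀⟩
      · simp [h0]
      have : Nonempty β := ⟨(hne o₀ ho₀).choose⟩
      choose! f hf using hne
      refine Finset.card_le_card_of_injOn f ?_ ?_
      · intro o ho
        have h1 := Finset.mem_sdiff.1 (hf o ho)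
        exact Finset.mem_sdiff.2
          ⟨Finset.mem_biUnion.2 ⟨o, (Finset.mem_sdiff.1 ho).1, h1.1⟩, h1.2⟩
      · intro o ho o' ho' he
        by_contra hoo
        have hk2 := key {o, o'} (by
          intro x hx
          rcases Finset.mem_insert.1 hx with rfl | hx
          · exact ho
          · rw [Finset.mem_singleton.1 hx]; exact ho') (by rw [Finset.card_pair hoo])
        rw [Finset.card_pair hoo] at hk2
        have hone : ∀ x ∈ hallLayers N O (j + 1) \ A, N x \ A.biUnion N = {f x} := by
          intro x hx
          have h1 := (Finset.mem_sdiff.1 hx).1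
          rw [hallLayers, Finset.mem_filter] at h1
          exact (Finset.eq_of_subset_of_card_le (Finset.singleton_subset_iff.2 (hf x hx))
            (by simpa using h1.2)).symm
        rw [Finset.biUnion_insert, Finset.singleton_biUnion, Finset.union_sdiff_distrib,
          hone o ho, hone o' ho', he] at hk2
        simp at hk2
    have e1 := Finset.card_sdiff_add_card_eq_card hstep
    have e2 := Finset.card_sdiff_add_card_eq_card
      (Finset.biUnion_subset_biUnion_of_subset_left N hstep)
    omega

/-- The theorem of Hurkens and Schrijver with an unspecified rate of convergence: a bipartite graph
with maximum degree `k` in which all small sets satisfy Hall's condition. -/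
theorem LocalHall.card_le {N : α → Finset β} {O : Finset α} {P : Finset β} {t k r : ℕ}
    (h : LocalHall N O t) (hNP : ∀ o ∈ O, N o ⊆ P) (hk : ∀ o ∈ O, (N o).card ≤ k) (hk2 : 2 ≤ k)
    (hP : ∀ p ∈ P, (O.filter fun o => p ∈ N o).card ≤ k) (hr : 0 < r)
    (ht : 2 * k * tightBound k r + 2 ≤ t) :
    r * (2 * O.card) ≤ r * (k * P.card) + 2 * O.card := by
  obtain ⟨j, hj, hjr⟩ : ∃ j < r, r * (hallLayers N O (j + 1)).card ≤
      r * (hallLayers N O j).card + O.card := by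
    by_contra! hcon
    -- Were every layer larger than `|O| / r`, the layers would together exceed `O`. The extra `1`
    -- for `j > 0` records that the inequality is strict.
    have : ∀ j ≤ r, j * O.card + (if j = 0 then 0 else 1) ≤ r * (hallLayers N O j).card := by
      intro j
      induction j with
      | zero => intro _; simp
      | succ j ih =>
        intro hj
        have h1 := ih (by omega)
        have h2 := hcon j (by omega)
        have h3 : (j + 1) * O.card = j * O.card + O.card := by ring
        rw [h3, if_neg (by omega)]
        omega
    have h1 := this r le_rfl
    rw [if_neg (by omega)] at h1
    have h2 := Nat.mul_le_mul_left r (Finset.card_le_card (hallLayers_subset N O r))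
    omega
  have hA := h.card_hallLayers_le hk (by omega) j (by
    have := Nat.mul_le_mul_left (2 * k) (tightBound_mono (k := k) (by omega) hj.le)
    omega)
  set A := hallLayers N O j with hAdef
  -- Double counting of edges between the unpeeled vertices, with at least two neighbours outside
  -- `N(A)` each, and those neighbours, of degree at most `k`.
  have hcount : (O \ hallLayers N O (j + 1)).card * 2 ≤ (P \ A.biUnion N).card * k := by
    refine Finset.card_mul_le_card_mul (fun o p => p ∈ N o) ?_ ?_
    · intro o ho
      obtain ⟨h1, h2⟩ := Finset.mem_sdiff.1 ho
      rw [hallLayers, Finset.mem_filter, not_and, not_le] at h2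
      refine le_trans (h2 h1) (Finset.card_le_card ?_)
      intro p hp
      obtain ⟨h3, h4⟩ := Finset.mem_sdiff.1 hp
      exact Finset.mem_filter.2 ⟨Finset.mem_sdiff.2 ⟨hNP o h1 h3, h4⟩, h3⟩
    · intro p hp
      refine le_trans (Finset.card_le_card ?_) (hP p (Finset.mem_sdiff.1 hp).1)
      intro o ho
      obtain ⟨h1, h2⟩ := Finset.mem_filter.1 ho
      exact Finset.mem_filter.2 ⟨(Finset.mem_sdiff.1 h1).1, h2⟩
  have e1 := Finset.card_sdiff_add_card_eq_card (hallLayers_subset N O (j + 1))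
  have e2 := Finset.card_sdiff_add_card_eq_card
    (Finset.biUnion_subset.2 fun o ho => hNP o (hallLayers_subset N O j ho) : A.biUnion N ⊆ P)
  -- Here `2|A| ≤ k|N(A)|`, from `|A| ≤ |N(A)|` and `2 ≤ k`.
  have e3 : 2 * O.card + 2 * A.card ≤ k * P.card + 2 * (hallLayers N O (j + 1)).card := by
    nlinarith
  nlinarith

end LocalHall

/-! ### Values computed by the list programs -/

namespace Timed

section Values

variable {α β : Type}

theorem val_bind {γ : Type} (x : Timed β) (f : β → Timed γ) : (x >>= f).val = (f x.val).val := rfl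

theorem steps_bind {γ : Type} (x : Timed β) (f : β → Timed γ) :
    (x >>= f).steps = x.steps + (f x.val).steps := rfl

theorem val_pure (a : β) : (pure a : Timed β).val = a := rfl

theorem steps_pure (a : β) : (pure a : Timed β).steps = 0 := rfl

theorem steps_tick : tick.steps = 1 := rfl

theorem val_ite (c : Prop) [Decidable c] (x y : Timed β) :
    (if c then x else y).val = if c then x.val else y.val := apply_ite _ _ _ _

theorem steps_ite (c : Prop) [Decidable c] (x y : Timed β) :
    (if c then x else y).steps = if c then x.steps else y.steps := apply_ite _ _ _ _

theorem appendT_val (xs ys : List β) : (appendT xs ys).val = xs ++ ys := by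
  induction xs with
  | nil => rfl
  | cons x xs ih => simp [appendT, val_bind, val_pure, ih]

theorem lengthT_val (xs : List β) : (lengthT xs).val = xs.length := by
  induction xs with
  | nil => rfl
  | cons x xs ih => simp [lengthT, val_bind, val_pure, ih]

theorem flattenT_val (xs : List (List β)) : (flattenT xs).val = xs.flatten := by
  induction xs with
  | nil => rfl
  | cons x xs ih => simp [flattenT, val_bind, appendT_val, ih]

theorem consAllT_val (x : β) (ls : List (List β)) :
    (consAllT x ls).val = ls.map fun l => x :: l := by
  induction ls with
  | nil => rfl
  | cons l ls ih => simp [consAllT, val_bind, val_pure, ih]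

theorem mem_sublistsT_val (i : ℕ) (l s : List β) :
    s ∈ (sublistsT i l).val ↔ s.Sublist l ∧ s.length = i := by
  induction l generalizing i s with
  | nil =>
    cases i with
    | zero => simp [sublistsT, val_bind, val_pure]
    | succ i =>
      simp only [sublistsT, val_bind, val_pure, List.not_mem_nil, false_iff, not_and,
        List.sublist_nil]
      rintro rfl
      simp
  | cons x l ih =>
    cases i with
    | zero =>
      simp only [sublistsT, val_bind, val_pure, List.mem_singleton, List.length_eq_zero_iff]
      exact ⟨fun h => ⟨h ▸ List.nil_sublist _, h⟩, And.right⟩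
    | succ i =>
      simp only [sublistsT, val_bind, appendT_val, consAllT_val, List.mem_append, List.mem_map, ih,
        List.sublist_cons_iff]
      constructor
      · rintro (⟨s, ⟨h1, rfl⟩, rfl⟩ | ⟨h1, h2⟩)
        · exact ⟨Or.inr ⟨s, rfl, h1⟩, rfl⟩
        · exact ⟨Or.inl h1, h2⟩
      · rintro ⟨h1 | ⟨r, rfl, h1⟩, h2⟩
        · exact Or.inr ⟨h1, h2⟩
        · exact Or.inl ⟨r, ⟨h1, by simpa using h2⟩, rfl⟩

theorem mem_sublistsUpToT_val (t : ℕ) (l s : List β) :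
    s ∈ (sublistsUpToT t l).val ↔ s.Sublist l ∧ s.length ≤ t := by
  induction t with
  | zero => simp [sublistsUpToT, val_bind, mem_sublistsT_val]
  | succ t ih =>
    simp only [sublistsUpToT, val_bind, appendT_val, List.mem_append, mem_sublistsT_val, ih]
    rw [← and_or_left]
    refine and_congr_right fun _ => ?_
    omega

variable [DecidableEq α]

theorem memT_val (x : α) (l : List α) : (memT x l).val = decide (x ∈ l) := by
  induction l with
  | nil => simp [memT, val_bind, val_pure]
  | cons y l ih =>
    by_cases h : x = y <;> simp [memT, val_bind, val_pure, ih, h]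

theorem subsetT_val (xs ys : List α) : (subsetT xs ys).val = true ↔ xs ⊆ ys := by
  induction xs with
  | nil => simp [subsetT, val_bind, val_pure]
  | cons x xs ih =>
    by_cases h : x ∈ ys <;> simp [subsetT, val_bind, val_pure, memT_val, ih, h]

theorem disjointT_val (xs ys : List α) : (disjointT xs ys).val = true ↔ xs.Disjoint ys := by
  induction xs with
  | nil => simp [disjointT, val_bind, val_pure]
  | cons x xs ih =>
    by_cases h : x ∈ ys <;> simp [disjointT, val_bind, val_pure, memT_val, ih, h]

theorem interT_val (xs ys : List α) : (interT xs ys).val = xs.filter fun x => x ∈ ys := by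
  induction xs with
  | nil => simp [interT, val_bind, val_pure]
  | cons x xs ih =>
    by_cases h : x ∈ ys <;> simp [interT, val_bind, val_pure, memT_val, ih, h]

theorem diffT_val (xs ys : List α) : (diffT xs ys).val = xs.filter fun x => x ∉ ys := by
  induction xs with
  | nil => simp [diffT, val_bind, val_pure]
  | cons x xs ih =>
    by_cases h : x ∈ ys <;> simp [diffT, val_bind, val_pure, memT_val, ih, h]

theorem disjointAllT_val (S : List α) (Ts : List (List α)) :
    (disjointAllT S Ts).val = true ↔ ∀ T ∈ Ts, S.Disjoint T := by
  induction Ts with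
  | nil => simp [disjointAllT, val_bind, val_pure]
  | cons T Ts ih =>
    by_cases h : S.Disjoint T
    · simp [disjointAllT, val_bind, (disjointT_val S T).2 h, h, ih]
    · have : (disjointT S T).val = false := by simpa [h] using (disjointT_val S T).not
      simp [disjointAllT, val_bind, val_pure, h, this]

theorem pairwiseDisjointT_val (Ts : List (List α)) :
    (pairwiseDisjointT Ts).val = true ↔ Ts.Pairwise List.Disjoint := by
  induction Ts with
  | nil => simp [pairwiseDisjointT, val_bind, val_pure]
  | cons T Ts ih =>
    by_cases h : ∀ S ∈ Ts, T.Disjoint S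
    · simp only [pairwiseDisjointT, val_bind, (disjointAllT_val T Ts).2 h, if_true, ih,
        List.pairwise_cons]
      exact (and_iff_right h).symm
    · have : (disjointAllT T Ts).val = false := by simpa [h] using (disjointAllT_val T Ts).not
      simp [pairwiseDisjointT, val_bind, val_pure, List.pairwise_cons, h, this]

theorem keepT_val (Q P : List (List α)) :
    (keepT Q P).val = P.filter fun S => (disjointAllT S Q).val := by
  induction P with
  | nil => simp [keepT, val_bind, val_pure]
  | cons S P ih =>
    cases h : (disjointAllT S Q).val <;> simp [keepT, val_bind, val_pure, ih, h]

theorem mem_freeSetsT_val (V : List α) (i : ℕ) (L : List (List α)) (s : List α) :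
    s ∈ (freeSetsT V i L).val ↔
      ∃ S ∈ L, s.Sublist (S.filter fun x => x ∈ V) ∧ s.length = i := by
  induction L with
  | nil => simp [freeSetsT, val_bind, val_pure]
  | cons S L ih =>
    simp [freeSetsT, val_bind, appendT_val, interT_val, mem_sublistsT_val, ih]

theorem improveT_val_eq_some {P P' : List (List α)} {Qs : List (List (List α))}
    (h : (improveT P Qs).val = some P') :
    ∃ Q ∈ Qs, Q.Pairwise List.Disjoint ∧ P' = Q ++ (keepT Q P).val ∧ P.length < P'.length := by
  induction Qs with
  | nil => simp [improveT, val_bind, val_pure] at h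
  | cons Q Qs ih =>
    have ih' : (improveT P Qs).val = some P' →
        ∃ R ∈ Q :: Qs, R.Pairwise List.Disjoint ∧ P' = R ++ (keepT R P).val ∧
          P.length < P'.length := fun h => by
      obtain ⟨R, hR, h2⟩ := ih h
      exact ⟨R, List.mem_cons_of_mem _ hR, h2⟩
    rw [improveT] at h
    simp only [val_bind, val_ite, val_pure, appendT_val, lengthT_val] at h
    split_ifs at h with h1 h2
    · have := (Option.some.inj h).symm
      subst this
      exact ⟨Q, List.mem_cons_self, (pairwiseDisjointT_val Q).1 h1, rfl, h2⟩
    · exact ih' h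
    · exact ih' h

theorem improveT_val_eq_none {P : List (List α)} {Qs : List (List (List α))}
    (h : (improveT P Qs).val = none) (Q : List (List α)) (hQ : Q ∈ Qs)
    (hd : Q.Pairwise List.Disjoint) : Q.length + (keepT Q P).val.length ≤ P.length := by
  induction Qs with
  | nil => simp at hQ
  | cons R Qs ih =>
    rw [improveT] at h
    simp only [val_bind, val_ite, val_pure, appendT_val, lengthT_val] at h
    rcases List.mem_cons.1 hQ with rfl | hQ
    · rw [if_pos ((pairwiseDisjointT_val Q).2 hd)] at h
      split_ifs at h with h2
      simpa using h2
    · split_ifs at h with h1 h2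
      · exact ih h hQ
      · exact ih h hQ

theorem containingT_val (S : List α) (L : List (List α)) (h : ∃ T ∈ L, S ⊆ T) :
    (containingT S L).val ∈ L ∧ S ⊆ (containingT S L).val := by
  induction L with
  | nil => simp at h
  | cons T L ih =>
    by_cases h1 : S ⊆ T
    · simp [containingT, val_bind, val_pure, (subsetT_val S T).2 h1, h1]
    · have h2 : (subsetT S T).val = false := by simpa [h1] using (subsetT_val S T).not
      have h3 := ih (by simpa [h1] using h)
      simp [containingT, val_bind, h2, h3]

/-- The legal execution needs a lifting map on finsets, while the program lifts lists whose order is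
accidental. A containing set must exist, since the default value is `S` itself and does depend on
the order. -/
theorem containingT_congr {S S' : List α} {L : List (List α)} (hS : ∀ x, x ∈ S ↔ x ∈ S')
    (h : ∃ T ∈ L, S ⊆ T) : (containingT S L).val = (containingT S' L).val := by
  induction L with
  | nil => simp at h
  | cons T L ih =>
    have h0 : S ⊆ T ↔ S' ⊆ T := by simp only [List.subset_def, hS]
    by_cases h1 : S ⊆ T
    · simp [containingT, val_bind, val_pure, (subsetT_val S T).2 h1,
        (subsetT_val S' T).2 (h0.1 h1)]
    · have h2 : (subsetT S T).val = false := by simpa [h1] using (subsetT_val S T).not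
      have h2' : (subsetT S' T).val = false := by simpa [h0.not.1 h1] using (subsetT_val S' T).not
      simp [containingT, val_bind, h2, h2', ih (by simpa [h1] using h)]

theorem liftT_val (L Ss : List (List α)) :
    (liftT L Ss).val = Ss.map fun S => (containingT S L).val := by
  induction Ss with
  | nil => rfl
  | cons S Ss ih => simp [liftT, val_bind, val_pure, ih]

end Values

end Timed

/-! ### Families of lists and the finsets they represent -/

theorem familyOf_append {n : ℕ} (L M : List (List (Fin n))) :
    familyOf (L ++ M) = familyOf L ∪ familyOf M := by
  simp [familyOf]

theorem mem_familyOf {n : ℕ} {L : List (List (Fin n))} {S : Finset (Fin n)} :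
    S ∈ familyOf L ↔ ∃ l ∈ L, l.toFinset = S := by
  simp [familyOf]

theorem sup_familyOf {n : ℕ} (L : List (List (Fin n))) :
    (familyOf L).sup id = L.flatten.toFinset := by
  ext x
  simp [Finset.mem_sup, mem_familyOf]

/-- Two equal sets that are disjoint are empty, so nonempty disjoint lists never represent the same
set. This makes list lengths agree with cardinalities. -/
theorem nodup_map_toFinset {n : ℕ} {L : List (List (Fin n))} (h : L.Pairwise List.Disjoint)
    (hne : ∀ l ∈ L, l ≠ []) : (L.map List.toFinset).Nodup := by
  rw [List.Nodup, List.pairwise_map]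
  refine h.imp_of_mem fun {a b} ha _ hab he => hne a ha ?_
  have := List.disjoint_toFinset_iff_disjoint.2 hab
  rw [← he, disjoint_self] at this
  simpa using this

theorem card_familyOf {n : ℕ} {L : List (List (Fin n))} (h : L.Pairwise List.Disjoint)
    (hne : ∀ l ∈ L, l ≠ []) : (familyOf L).card = L.length := by
  rw [familyOf, List.toFinset_card_of_nodup (nodup_map_toFinset h hne), List.length_map]

theorem pairwiseDisjoint_familyOf {n : ℕ} {L : List (List (Fin n))}
    (h : L.Pairwise List.Disjoint) :
    (familyOf L : Set (Finset (Fin n))).PairwiseDisjoint id := by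
  intro S hS T hT hST
  obtain ⟨l, hl, rfl⟩ := mem_familyOf.1 hS
  obtain ⟨m, hm, rfl⟩ := mem_familyOf.1 hT
  have : l ≠ m := fun e => hST (e ▸ rfl)
  have : Std.Symm (List.Disjoint (α := Fin n)) := ⟨fun _ _ h => h.symm⟩
  exact List.disjoint_toFinset_iff_disjoint.2 (h.forall hl hm ‹l ≠ m›)

/-- Each list uses up an element of `V` of its own. This bounds the number of improvements in local
search. -/
theorem length_le_of_pairwise_disjoint {α : Type*} {P : List (List α)} {V : List α}
    (hP : P.Pairwise List.Disjoint) (h : ∀ l ∈ P, l ≠ [] ∧ l.Nodup ∧ l ⊆ V) :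
    P.length ≤ V.length := by
  have h1 : P.length ≤ P.flatten.length := by
    clear hP
    induction P with
    | nil => simp
    | cons l P ih =>
      have := ih fun m hm => h m (List.mem_cons_of_mem _ hm)
      have := List.length_pos_iff.2 (h l List.mem_cons_self).1
      simp only [List.length_cons, List.flatten_cons, List.length_append]
      omega
  have h2 : P.flatten.Nodup := List.nodup_flatten.2 ⟨fun l hl => (h l hl).2.1, hP⟩
  refine h1.trans (List.Nodup.subperm h2 ?_).length_le
  intro x hx
  obtain ⟨l, hl, hxl⟩ := List.mem_flatten.1 hx
  exact (h l hl).2.2 hxl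

/-- A pairwise disjoint collection contains at most `|s|` sets that meet `s`. -/
theorem card_le_card_of_not_disjoint {α : Type*} [DecidableEq α] {F : Finset (Finset α)}
    (s : Finset α) (hF : (F : Set (Finset α)).PairwiseDisjoint id)
    (h : ∀ S ∈ F, ¬ Disjoint s S) : F.card ≤ s.card := by
  have h' : ∀ S ∈ F, ∃ x, x ∈ s ∧ x ∈ S := fun S hS => Finset.not_disjoint_iff.1 (h S hS)
  rcases F.eq_empty_or_nonempty with rfl | ⟨S₀, hS₀⟩
  · simp
  have : Nonempty α := ⟨(h' S₀ hS₀).choose⟩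
  choose! f hf using h'
  refine Finset.card_le_card_of_injOn f (fun S hS => (hf S hS).1) ?_
  intro S hS T hT he
  by_contra hne
  exact Finset.disjoint_left.1 (hF hS hT hne) (hf S hS).2 (he ▸ (hf T hT).2)

/-! ### Local search ends in a local optimum -/

namespace Timed

section Search

variable {α : Type} [DecidableEq α]

/-- The lists in `P` are pairwise disjoint and taken from `C`. -/
def IsListPacking (C P : List (List α)) : Prop :=
  (∀ l ∈ P, l ∈ C) ∧ P.Pairwise List.Disjoint

theorem IsListPacking.append_keepT {C P Q : List (List α)} (hP : IsListPacking C P)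
    (hQ : IsListPacking C Q) : IsListPacking C (Q ++ (keepT Q P).val) := by
  rw [keepT_val]
  refine ⟨fun l hl => ?_, List.pairwise_append.2 ⟨hQ.2, hP.2.filter _, fun a ha b hb => ?_⟩⟩
  · rcases List.mem_append.1 hl with h | h
    · exact hQ.1 l h
    · exact hP.1 l (List.mem_filter.1 h).1
  · exact ((disjointAllT_val b Q).1 (List.mem_filter.1 hb).2 a ha).symm

/-- The invariant `hm` says that the remaining rounds suffice: each improvement enlarges the
packing, and a packing has at most `|V|` members. When the counter reaches `0`, a further
improvement would exceed that number. -/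
theorem localSearchT_val {C : List (List α)} {V : List α} {Qs : List (List (List α))}
    (hQs : ∀ Q ∈ Qs, ∀ l ∈ Q, l ∈ C) (hC : ∀ l ∈ C, l ≠ [] ∧ l.Nodup ∧ l ⊆ V)
    (m : ℕ) (P : List (List α)) (hP : IsListPacking C P) (hm : V.length ≤ m + P.length) :
    IsListPacking C (localSearchT Qs m P).val ∧
      (improveT (localSearchT Qs m P).val Qs).val = none := by
  have hstep : ∀ {P P' : List (List α)}, IsListPacking C P → (improveT P Qs).val = some P' →
      IsListPacking C P' ∧ P.length < P'.length := by
    intro P P' hP h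
    obtain ⟨Q, hQ, hd, rfl, hlt⟩ := improveT_val_eq_some h
    exact ⟨hP.append_keepT ⟨hQs Q hQ, hd⟩, hlt⟩
  induction m generalizing P with
  | zero =>
    refine ⟨hP, ?_⟩
    simp only [localSearchT, val_bind, val_pure]
    by_contra hne
    obtain ⟨P', hP'⟩ := Option.ne_none_iff_exists'.1 hne
    obtain ⟨h1, h2⟩ := hstep hP hP'
    have := length_le_of_pairwise_disjoint h1.2 fun l hl => hC l (h1.1 l hl)
    omega
  | succ m ih =>
    simp only [localSearchT, val_bind]
    cases h : (improveT P Qs).val with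
    | none => exact ⟨hP, h⟩
    | some P' =>
      obtain ⟨h1, h2⟩ := hstep hP h
      exact ih P' h1 (by omega)

theorem packT_val {t i : ℕ} {L : List (List α)} {V : List α} (hL : ∀ S ∈ L, S.Nodup)
    (hi : 0 < i) :
    IsListPacking (freeSetsT V i L).val (packT t L V i).val ∧
    ∀ Q : List (List α), Q.Sublist (freeSetsT V i L).val → Q.length ≤ t →
      Q.Pairwise List.Disjoint →
      Q.length + (keepT Q (packT t L V i).val).val.length ≤ (packT t L V i).val.length := by
  have h := localSearchT_val (C := (freeSetsT V i L).val) (V := V)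
    (Qs := (sublistsUpToT t (freeSetsT V i L).val).val)
    (fun Q hQ l hl => ((mem_sublistsUpToT_val _ _ _).1 hQ).1.subset hl)
    (fun l hl => by
      obtain ⟨S, hS, h1, h2⟩ := (mem_freeSetsT_val _ _ _ _).1 hl
      refine ⟨?_, ((hL S hS).filter _).sublist h1, fun x hx => ?_⟩
      · rintro rfl
        simp at h2
        omega
      · simpa using (List.mem_filter.1 (h1.subset hx)).2)
    V.length [] ⟨by simp, List.Pairwise.nil⟩ (by simp)
  have hval : (packT t L V i).val =
      (localSearchT (sublistsUpToT t (freeSetsT V i L).val).val V.length []).val := by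
    simp [packT, val_bind, lengthT_val]
  rw [hval]
  exact ⟨h.1, fun Q hQ ht hd => improveT_val_eq_none h.2 Q
    ((mem_sublistsUpToT_val _ _ _).2 ⟨hQ, ht⟩) hd⟩

/-- By the invariant `hB`, a block is emitted before the end of the list only with exactly `p`
elements, so only the last block can be short. -/
theorem blocksT_val {α : Type} (p : ℕ) (hp : 0 < p) (B : List α) (r : ℕ) (V : List α)
    (hB : B.length + r = p) :
    (blocksT p B r V).val.flatten.Perm (B ++ V) ∧
    (∀ S ∈ (blocksT p B r V).val, S ≠ [] ∧ S.length ≤ p) ∧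
    ((blocksT p B r V).val.filter fun S => S.length < p).length ≤ 1 := by
  induction V generalizing B r with
  | nil =>
    cases B with
    | nil => simp [blocksT, val_bind, val_pure]
    | cons y B =>
      simp only [blocksT, val_bind, val_pure]
      refine ⟨by simp, by simpa using by simp at hB; omega, ?_⟩
      exact (List.length_filter_le _ _).trans (by simp)
  | cons x V ih =>
    cases r with
    | zero =>
      simp only [blocksT, val_bind, val_pure]
      obtain ⟨h1, h2, h3⟩ := ih [x] (p - 1) (by simp; omega)
      refine ⟨?_, ?_, ?_⟩
      · simpa using h1.append_left B
      · intro S hS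
        rcases List.mem_cons.1 hS with rfl | hS
        · exact ⟨fun h => by simp [h] at hB; omega, by omega⟩
        · exact h2 S hS
      · rw [List.filter_cons_of_neg (by simp; omega)]
        exact h3
    | succ r =>
      simp only [blocksT, val_bind]
      obtain ⟨h1, h2, h3⟩ := ih (x :: B) r (by simp; omega)
      exact ⟨h1.trans (by simpa using List.perm_middle.symm), h2, h3⟩

end Search

end Timed

/-! ### Local optima are legal outcomes of a packing phase -/

namespace UUSC

variable {p k n : ℕ}

theorem isFreeSet_of_mem_freeSetsT {I : UUSC p k n} {L : List (List (Fin n))}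
    (hI : I.IsEncodedBy L) {V : List (Fin n)} {i : ℕ} {l : List (Fin n)}
    (hl : l ∈ (Timed.freeSetsT V i L).val) :
    l.Nodup ∧ l.length = i ∧ l ⊆ V ∧ I.IsFreeSet V.toFinset i l.toFinset ∧ ∃ T ∈ L, l ⊆ T := by
  obtain ⟨S, hS, h1, h2⟩ := (Timed.mem_freeSetsT_val _ _ _ _).1 hl
  have hn : l.Nodup := ((hI.1 S hS).filter _).sublist h1
  have hV : l ⊆ V := fun x hx => by simpa using (List.mem_filter.1 (h1.subset hx)).2
  have hS' : l ⊆ S := fun x hx => (List.mem_filter.1 (h1.subset hx)).1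
  refine ⟨hn, h2, hV, ⟨?_, ?_, S.toFinset, ?_, ?_⟩, S, hS, hS'⟩
  · intro x hx
    exact List.mem_toFinset.2 (hV (List.mem_toFinset.1 hx))
  · rw [List.toFinset_card_of_nodup hn, h2]
  · rw [← hI.2]
    exact mem_familyOf.2 ⟨S, hS, rfl⟩
  · intro x hx
    exact List.mem_toFinset.2 (hS' (List.mem_toFinset.1 hx))

theorem IsFreeSet.exists_mem_freeSetsT {I : UUSC p k n} {L : List (List (Fin n))}
    (hI : I.IsEncodedBy L) {V : List (Fin n)} {i : ℕ} {S : Finset (Fin n)}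
    (hS : I.IsFreeSet V.toFinset i S) : ∃ l ∈ (Timed.freeSetsT V i L).val, l.toFinset = S := by
  obtain ⟨hV, hc, T, hT, hST⟩ := hS
  rw [← hI.2] at hT
  obtain ⟨m, hm, rfl⟩ := mem_familyOf.1 hT
  have he : (m.filter fun x => x ∈ S).toFinset = S := by
    ext x
    simp only [List.mem_toFinset, List.mem_filter, decide_eq_true_eq, and_iff_right_iff_imp]
    exact fun hx => List.mem_toFinset.1 (hST hx)
  -- The representative of `S` inherits its order from `m`, because only sublists of the input lists
  -- are enumerated.
  refine ⟨m.filter fun x => x ∈ S, (Timed.mem_freeSetsT_val _ _ _ _).2 ⟨m, hm, ?_, ?_⟩, he⟩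
  · refine List.monotone_filter_right m fun x hx => ?_
    simpa using hV (by simpa using hx)
  · rw [← List.toFinset_card_of_nodup ((hI.1 m hm).filter _), he, hc]

/-- In a packing that local search cannot improve, small packings have enough neighbours. -/
theorem localHall_packT {I : UUSC p k n} {L : List (List (Fin n))} (hI : I.IsEncodedBy L)
    {V : List (Fin n)} {i t : ℕ} (hi : 0 < i) {O : Finset (Finset (Fin n))}
    (hO : I.IsPacking V.toFinset i O) :
    LocalHall (fun o => (familyOf (Timed.packT t L V i).val).filter fun S => ¬ Disjoint o S)
      O t := by
  intro X hX hXt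
  obtain ⟨hR, hloc⟩ := Timed.packT_val (t := t) (V := V) hI.1 hi
  set R := (Timed.packT t L V i).val with hRdef
  have hrep : ∀ S ∈ O, ∃ l, l ∈ (Timed.freeSetsT V i L).val ∧ l.toFinset = S := fun S hS =>
    (hO.1 S hS).exists_mem_freeSetsT hI
  choose! ρ hρ using hrep
  have hq0 : (X.toList.map ρ).Nodup := by
    refine (Finset.nodup_toList X).map_on fun S hS T hT he => ?_
    rw [← (hρ S (hX (Finset.mem_toList.1 hS))).2, ← (hρ T (hX (Finset.mem_toList.1 hT))).2, he]
  -- The search tests sublists of the enumeration only, so the representatives of `X` have to be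
  -- rearranged into its order.
  obtain ⟨Q, hQp, hQs⟩ : (X.toList.map ρ).Subperm (Timed.freeSetsT V i L).val := by
    refine hq0.subperm fun l hl => ?_
    obtain ⟨S, hS, rfl⟩ := List.mem_map.1 hl
    exact (hρ S (hX (Finset.mem_toList.1 hS))).1
  have hQl : Q.length = X.card := by rw [hQp.length_eq]; simp
  have hQd : Q.Pairwise List.Disjoint := by
    rw [hQp.pairwise_iff fun h => h.symm, List.pairwise_map]
    refine (Finset.nodup_toList X).imp_of_mem fun {S T} hS hT hne => ?_
    have hS := hX (Finset.mem_toList.1 hS)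
    have hT := hX (Finset.mem_toList.1 hT)
    rw [← List.disjoint_toFinset_iff_disjoint, (hρ S hS).2, (hρ T hT).2]
    exact hO.2 hS hT hne
  have h1 := hloc Q hQs (by omega) hQd
  have hne : ∀ l ∈ R, l ≠ [] := fun l hl h0 => by
    have := (isFreeSet_of_mem_freeSetsT hI (hR.1 l hl)).2.1
    simp [h0] at this
    omega
  rw [Timed.keepT_val, hQl] at h1
  -- Since inserting `Q` does not improve `R`, at least `|X|` members of `R` are removed; each of
  -- them meets a member of `X`.
  have h2 : R.length = (R.filter fun S => (Timed.disjointAllT S Q).val).length +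
      (R.filter fun S => !(Timed.disjointAllT S Q).val).length := by
    rw [← List.length_append]
    exact (List.filter_append_perm _ R).length_eq.symm
  have h3 : (R.filter fun S => !(Timed.disjointAllT S Q).val).length ≤
      (X.biUnion fun o => (familyOf R).filter fun S => ¬ Disjoint o S).card := by
    rw [← card_familyOf (hR.2.filter _) fun l hl => hne l (List.mem_filter.1 hl).1]
    refine Finset.card_le_card fun S hS => ?_
    obtain ⟨l, hl, rfl⟩ := mem_familyOf.1 hS
    obtain ⟨hlR, hlQ⟩ := List.mem_filter.1 hl
    have : ¬ ∀ m ∈ Q, l.Disjoint m := by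
      rw [← Timed.disjointAllT_val]
      simpa using hlQ
    push Not at this
    obtain ⟨m, hm, hd⟩ := this
    obtain ⟨T, hT, rfl⟩ := List.mem_map.1 (hQp.subset hm)
    have hTX := Finset.mem_toList.1 hT
    refine Finset.mem_biUnion.2 ⟨T, hTX, Finset.mem_filter.2
      ⟨mem_familyOf.2 ⟨l, hlR, rfl⟩, fun hdis => hd ?_⟩⟩
    rw [← List.disjoint_toFinset_iff_disjoint, (hρ T (hX hTX)).2]
    exact hdis.symm
  omega

/-- Hall's condition for a single `i`-set is maximality. For the ratio, both degrees are at most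
`i`, because an `i`-set meets at most `i` disjoint sets; `r` layers give the factor `(2 - 2 / r) /
i`. -/
theorem isPhaseOutcome_packT {I : UUSC p k n} {L : List (List (Fin n))} (hI : I.IsEncodedBy L)
    (V : List (Fin n)) {i t r : ℕ} (hi : 2 ≤ i) (hr : 0 < r)
    (ht : 2 * i * tightBound i r + 2 ≤ t) {ε : ℝ} (hε : 2 / (r : ℝ) ≤ ε) :
    I.IsPhaseOutcome ε V.toFinset i (familyOf (Timed.packT t L V i).val) := by
  obtain ⟨hR, -⟩ := Timed.packT_val (t := t) (V := V) hI.1 (by omega : 0 < i)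
  have hpack : I.IsPacking V.toFinset i (familyOf (Timed.packT t L V i).val) := by
    refine ⟨fun S hS => ?_, pairwiseDisjoint_familyOf hR.2⟩
    obtain ⟨l, hl, rfl⟩ := mem_familyOf.1 hS
    exact (isFreeSet_of_mem_freeSetsT hI (hR.1 l hl)).2.2.2.1
  refine ⟨hpack, fun S hS => ?_, fun O hO => ?_⟩
  · have h := localHall_packT (t := t) hI (by omega : 0 < i) (O := {S})
      ⟨by simpa using hS, by simp⟩ {S} subset_rfl (by simp; omega)
    rw [Finset.singleton_biUnion, Finset.card_singleton, Nat.succ_le_iff, Finset.card_pos] at h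
    obtain ⟨T, hT⟩ := h
    exact ⟨T, Finset.mem_filter.1 hT⟩
  · have h := (localHall_packT (t := t) hI (by omega : 0 < i) hO).card_le (k := i) (r := r)
      (fun o _ => Finset.filter_subset _ _)
      (fun o ho => ?_) hi (fun S hS => ?_) hr ht
    · have hr' : (0 : ℝ) < r := by exact_mod_cast hr
      have hi' : (0 : ℝ) < i := by exact_mod_cast (by omega : 0 < i)
      have hc : (r : ℝ) * (2 * O.card) ≤
          r * (i * (familyOf (Timed.packT t L V i).val).card) + 2 * O.card := by
        exact_mod_cast h
      have hεr : 2 ≤ ε * r := by rwa [div_le_iff₀ hr'] at hε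
      rw [div_mul_eq_mul_div, div_le_iff₀ hi']
      have h2 : 2 * (O.card : ℝ) ≤ ε * r * O.card :=
        mul_le_mul_of_nonneg_right hεr (Nat.cast_nonneg _)
      refine le_of_mul_le_mul_left ?_ hr'
      nlinarith
    · refine le_of_le_of_eq ?_ (hO.1 o ho).2.1
      refine card_le_card_of_not_disjoint o (hpack.2.subset ?_) fun S hS =>
        (Finset.mem_filter.1 hS).2
      exact Finset.coe_subset.2 (Finset.filter_subset _ _)
    · refine le_of_le_of_eq ?_ (hpack.1 S hS).2.1
      refine card_le_card_of_not_disjoint S (hO.2.subset ?_) fun o ho => ?_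
      · exact Finset.coe_subset.2 (Finset.filter_subset _ _)
      · exact fun hd => (Finset.mem_filter.1 (Finset.mem_filter.1 ho).2).2 hd.symm

end UUSC

/-! ### The approximation ratio -/

namespace UUSC

section Ratio

variable {p k n : ℕ} {I : UUSC p k n}

theorem exists_isCover_card_eq_opt (I : UUSC p k n) : ∃ F, I.IsCover F ∧ F.card = I.opt :=
  Nat.sInf_mem (s := {m : ℕ | ∃ F : Finset (Finset (Fin n)), I.IsCover F ∧ F.card = m})
    ⟨I.sets.card, I.sets, ⟨subset_rfl, I.covers⟩, rfl⟩

theorem IsPacking.sup_subset {V : Finset (Fin n)} {i : ℕ} {P : Finset (Finset (Fin n))}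
    (hP : I.IsPacking V i P) : P.sup id ⊆ V :=
  Finset.sup_le fun S hS => (hP.1 S hS).1

theorem IsPacking.card_sup {V : Finset (Fin n)} {i : ℕ} {P : Finset (Finset (Fin n))}
    (hP : I.IsPacking V i P) : (P.sup id).card = P.card * i := by
  rw [Finset.sup_eq_biUnion, Finset.card_biUnion fun S hS T hT h => hP.2 hS hT h]
  exact Finset.sum_const_nat fun S hS => (hP.1 S hS).2.1

theorem IsPacking.card_add {V : Finset (Fin n)} {i : ℕ} {P : Finset (Finset (Fin n))}
    (hP : I.IsPacking V i P) : (V \ P.sup id).card + P.card * i = V.card := by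
  rw [← hP.card_sup]
  exact Finset.card_sdiff_add_card_eq_card hP.sup_subset

theorem Run.sup_eq {ε : ℝ} {i : ℕ} {V : Finset (Fin n)} {D : Finset (Finset (Fin n))}
    (h : I.Run ε i V D) : D.sup id = V := by
  induction h with
  | final V Q hQ => exact hQ.2.1
  | phase i V P R hi hP hR ih =>
    rw [Finset.sup_union, ih]
    exact Finset.union_sdiff_of_subset hP.1.sup_subset

theorem IsFinalOutcome.two_mul_card_le {V : Finset (Fin n)} {Q : Finset (Finset (Fin n))}
    (h : IsFinalOutcome 2 V Q) : 2 * Q.card ≤ V.card + 1 := by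
  obtain ⟨hd, hs, hc, h1⟩ := h
  rw [← hs, Finset.sup_eq_biUnion, Finset.card_biUnion fun S hS T hT h => hd hS hT h]
  -- A nonempty set of size below two is a singleton, so one extra unit lifts it to two; at most one
  -- such unit is needed.
  have h2 : ∑ S ∈ Q, 2 ≤ ∑ S ∈ Q, ((id S).card + if S.card < 2 then 1 else 0) := by
    refine Finset.sum_le_sum fun S hS => ?_
    have := Finset.card_pos.2 (hc S hS).1
    simp only [id]
    split_ifs <;> omega
  rw [Finset.sum_add_distrib, ← Finset.card_filter] at h2
  simp only [Finset.sum_const, smul_eq_mul] at h2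
  omega

theorem Run.two_mul_card_le {I : UUSC 2 k n} {ε : ℝ} {i : ℕ} {V : Finset (Fin n)}
    {D : Finset (Finset (Fin n))} (h : I.Run ε i V D) : 2 * D.card ≤ V.card + 1 := by
  induction h with
  | final V Q hQ => exact hQ.two_mul_card_le
  | phase i V P R hi hP hR ih =>
    have h1 := hP.1.card_add
    have h2 := Finset.card_union_le P R
    have h3 := Nat.mul_le_mul_left P.card hi.le
    omega

/-- The sets of a cover that are assigned `k` elements form a packing, and the other ones have
fewer elements. -/
theorem exists_isPacking_univ (hk : 0 < k) :
    ∃ O, I.IsPacking Finset.univ k O ∧ O.card ≤ I.opt ∧ n ≤ (k - 1) * I.opt + O.card := by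
  obtain ⟨F, ⟨hFI, hF⟩, hopt⟩ := I.exists_isCover_card_eq_opt
  choose g hgF hg using hF
  -- The elements assigned to `T`: the fibres of `g` turn the cover into a partition, with parts
  -- inside members of the cover.
  let fib : Finset (Fin n) → Finset (Fin n) := fun T => Finset.univ.filter fun x => g x = T
  have hfib : ∀ T, fib T ⊆ T := fun T x hx => by
    have := (Finset.mem_filter.1 hx).2
    exact this ▸ hg x
  -- A nonempty fibre determines its set; fibres of size `k` are nonempty because `0 < k`.
  have hinj : Set.InjOn fib (F.filter fun T => (fib T).card = k) := by
    intro S hS T hT he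
    have hS := (Finset.mem_filter.1 hS).2
    obtain ⟨x, hx⟩ := Finset.card_pos.1 (hS ▸ hk : 0 < (fib S).card)
    have h1 := (Finset.mem_filter.1 hx).2
    rw [he] at hx
    exact h1.symm.trans (Finset.mem_filter.1 hx).2
  refine ⟨(F.filter fun T => (fib T).card = k).image fib, ⟨?_, ?_⟩, ?_, ?_⟩
  · intro S hS
    obtain ⟨T, hT, rfl⟩ := Finset.mem_image.1 hS
    obtain ⟨hTF, hc⟩ := Finset.mem_filter.1 hT
    exact ⟨Finset.subset_univ _, hc, T, hFI hTF, hfib T⟩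
  · intro S hS S' hS' hne
    obtain ⟨T, -, rfl⟩ := Finset.mem_image.1 hS
    obtain ⟨T', -, rfl⟩ := Finset.mem_image.1 hS'
    refine Finset.disjoint_left.2 fun x hx hx' => hne ?_
    rw [← (Finset.mem_filter.1 hx).2, ← (Finset.mem_filter.1 hx').2]
  · rw [← hopt]
    exact Finset.card_image_le.trans (Finset.card_filter_le _ _)
  · rw [Finset.card_image_of_injOn hinj, ← hopt, Finset.card_filter, mul_comm, ← smul_eq_mul,
      ← Finset.sum_const, ← Finset.sum_add_distrib]
    have h1 : n = ∑ T ∈ F, (fib T).card := by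
      have := Finset.card_eq_sum_card_fiberwise (s := (Finset.univ : Finset (Fin n))) (t := F)
        (f := g) fun x _ => hgF x
      simpa using this
    refine h1.le.trans (Finset.sum_le_sum fun T hT => ?_)
    have := (Finset.card_le_card (hfib T)).trans (I.card_le T (hFI hT))
    split_ifs <;> omega

/-- A 4-set of `P` counts once but uses up four elements, and the remaining elements cost about one
half each. So each member of `P` saves one set against pairing up everything, and half of `|O|` is
saved up to the error from `ε`. -/
theorem Run.card_le_opt {I : UUSC 2 4 n} {ε : ℝ} (hε : 0 ≤ ε) {D : Finset (Finset (Fin n))}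
    (h : I.Run ε 4 Finset.univ D) : (D.card : ℝ) ≤ (3 / 2 + ε) * (I.opt : ℝ) + 1 := by
  obtain ⟨O, hO, hOo, hn⟩ := I.exists_isPacking_univ (by norm_num)
  cases h with
  | phase _ _ P R hi hP hR =>
    have h1 := hP.1.card_add
    have h2 := Finset.card_union_le P R
    have h3 := hR.two_mul_card_le
    have h4 := hP.2.2 O hO
    rw [Finset.card_univ, Fintype.card_fin] at h1
    -- Combines `2|R| ≤ n - 4|P| + 1` with `n ≤ 3 * OPT + |O|`.
    have h5 : 2 * (P ∪ R).card + 2 * P.card ≤ 3 * I.opt + O.card + 1 := by omega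
    have h5' : 2 * ((P ∪ R).card : ℝ) + 2 * P.card ≤ 3 * I.opt + O.card + 1 := by
      exact_mod_cast h5
    have h6 : (O.card : ℝ) ≤ I.opt := by exact_mod_cast hOo
    have h7 := mul_le_mul_of_nonneg_left h6 hε
    have h8 : 0 ≤ ε * (I.opt : ℝ) := by positivity
    push_cast at h4
    nlinarith

theorem IsA1Output.isCover {ε : ℝ} {D APX : Finset (Finset (Fin n))}
    (h : I.IsA1Output ε D APX) : I.IsCover APX := by
  obtain ⟨hr, f, hf, rfl⟩ := h
  refine ⟨fun S hS => ?_, fun x => ?_⟩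
  · obtain ⟨T, hT, rfl⟩ := Finset.mem_image.1 hS
    exact (hf T hT).1
  · have hx : x ∈ D.sup id := by rw [hr.sup_eq]; exact Finset.mem_univ x
    obtain ⟨S, hS, hxS⟩ := Finset.mem_sup.1 hx
    exact ⟨f S, Finset.mem_image_of_mem f hS, (hf S hS).2 hxS⟩

theorem IsA1Output.card_le {ε : ℝ} {D APX : Finset (Finset (Fin n))}
    (h : I.IsA1Output ε D APX) : APX.card ≤ D.card := by
  obtain ⟨-, f, -, rfl⟩ := h
  exact Finset.card_image_le

end Ratio

/-! ### The program performs a legal execution -/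

section Execution

variable {k n : ℕ} {I : UUSC 2 k n} {L : List (List (Fin n))}

theorem IsEncodedBy.length_le (hI : I.IsEncodedBy L) {S : List (Fin n)} (hS : S ∈ L) :
    S.length ≤ k := by
  rw [← List.toFinset_card_of_nodup (hI.1 S hS)]
  refine I.card_le _ ?_
  rw [← hI.2]
  exact mem_familyOf.2 ⟨S, hS, rfl⟩

/-- Needed for the blocks of the final phase: pairs belong to the input by `all_small`, and a
singleton lies in some input set by `covers`. -/
theorem IsEncodedBy.exists_superset (hI : I.IsEncodedBy L) {S : List (Fin n)} (hn : S.Nodup)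
    (h0 : S ≠ []) (h2 : S.length ≤ 2) : ∃ T ∈ L, S ⊆ T := by
  have key : ∀ T ∈ I.sets, S.toFinset ⊆ T → ∃ T ∈ L, S ⊆ T := by
    intro T hT hST
    rw [← hI.2] at hT
    obtain ⟨m, hm, rfl⟩ := mem_familyOf.1 hT
    exact ⟨m, hm, fun x hx => List.mem_toFinset.1 (hST (List.mem_toFinset.2 hx))⟩
  rcases h2.lt_or_eq with h | h
  · have := List.length_pos_iff.2 h0
    obtain ⟨x, rfl⟩ := List.length_eq_one_iff.1 (by omega : S.length = 1)
    obtain ⟨T, hT, hx⟩ := I.covers x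
    exact key T hT (by simpa using hx)
  · exact key _ (I.all_small _ (by rw [List.toFinset_card_of_nodup hn, h])) subset_rfl

/-- Besides legality, the induction carries that the selected lists partition `V`, are nonempty and
fit into input sets: what lifting, the count of the output and the step bound use. -/
theorem run_phasesT (hI : I.IsEncodedBy L) {ε : ℝ} {r t : ℕ} (hr : 0 < r)
    (hε : 2 / (r : ℝ) ≤ ε) (d : ℕ)
    (ht : ∀ i ≤ 2 + d, 2 * i * tightBound i r + 2 ≤ t) (V : List (Fin n)) (hV : V.Nodup) :
    I.Run ε (2 + d) V.toFinset (familyOf (Timed.phasesT 2 t L d V).val) ∧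
    (Timed.phasesT 2 t L d V).val.flatten.Perm V ∧
    ∀ S ∈ (Timed.phasesT 2 t L d V).val, S ≠ [] ∧ ∃ T ∈ L, S ⊆ T := by
  induction d generalizing V with
  | zero =>
    obtain ⟨h1, h2, h3⟩ := Timed.blocksT_val 2 (by norm_num) [] 2 V (by simp)
    have hval : (Timed.phasesT 2 t L 0 V).val = (Timed.blocksT 2 [] 2 V).val := by
      simp [Timed.phasesT, Timed.val_bind]
    rw [hval]
    set R := (Timed.blocksT 2 [] 2 V).val
    rw [List.nil_append] at h1
    obtain ⟨hn, hd⟩ := List.nodup_flatten.1 (h1.nodup_iff.2 hV)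
    refine ⟨Run.final _ _ ⟨pairwiseDisjoint_familyOf hd, ?_, fun S hS => ?_, ?_⟩, h1,
      fun S hS => ⟨(h2 S hS).1, hI.exists_superset (hn S hS) (h2 S hS).1 (h2 S hS).2⟩⟩
    · rw [sup_familyOf]
      exact List.toFinset_eq_of_perm _ _ h1
    · obtain ⟨l, hl, rfl⟩ := mem_familyOf.1 hS
      rw [List.toFinset_card_of_nodup (hn l hl), List.toFinset_nonempty_iff]
      exact h2 l hl
    · have hsub : (familyOf R).filter (fun S => S.card < 2) ⊆
          familyOf (R.filter fun S => S.length < 2) := by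
        intro S hS
        obtain ⟨hS, hc⟩ := Finset.mem_filter.1 hS
        obtain ⟨l, hl, rfl⟩ := mem_familyOf.1 hS
        rw [List.toFinset_card_of_nodup (hn l hl)] at hc
        exact mem_familyOf.2 ⟨l, List.mem_filter.2 ⟨hl, by simpa using hc⟩, rfl⟩
      refine (Finset.card_le_card hsub).trans (le_trans (List.toFinset_card_le _) ?_)
      simpa using h3
  | succ d ih =>
    have hpos : 0 < 2 + d + 1 := by omega
    obtain ⟨hP, -⟩ := Timed.packT_val (t := t) (V := V) hI.1 hpos
    have hout := isPhaseOutcome_packT (t := t) hI V (i := 2 + d + 1) (by omega) hr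
      (ht _ (by omega)) hε
    set P := (Timed.packT t L V (2 + d + 1)).val with hPdef
    set W := V.filter fun x => x ∉ P.flatten with hW
    have hval : (Timed.phasesT 2 t L (d + 1) V).val = P ++ (Timed.phasesT 2 t L d W).val := by
      simp only [Timed.phasesT, Timed.val_bind, Timed.appendT_val, Timed.flattenT_val,
        Timed.diffT_val]
      rfl
    obtain ⟨h1, h2, h3⟩ := ih (fun i hi => ht i (by omega)) W (hV.filter _)
    have hmem := fun l hl => isFreeSet_of_mem_freeSetsT hI (hP.1 l hl)
    rw [hval]
    refine ⟨?_, ?_, fun S hS => ?_⟩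
    · rw [familyOf_append]
      refine Run.phase _ _ _ _ (by omega) hout ?_
      have : V.toFinset \ (familyOf P).sup id = W.toFinset := by
        rw [sup_familyOf]
        ext x
        simp [hW]
      rw [this]
      exact h1
    · have hPf : P.flatten.Nodup := List.nodup_flatten.2 ⟨fun l hl => (hmem l hl).1, hP.2⟩
      rw [List.flatten_append]
      refine (h2.append_left _).trans ?_
      refine (List.perm_ext_iff_of_nodup ?_ hV).2 fun x => ?_
      · refine hPf.append (hV.filter _) fun x hx hx' => ?_
        have := (List.mem_filter.1 hx').2
        simp only [decide_eq_true_eq] at this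
        exact this hx
      · have hPV : x ∈ P.flatten → x ∈ V := fun hx => by
          obtain ⟨l, hl, hxl⟩ := List.mem_flatten.1 hx
          exact (hmem l hl).2.2.1 hxl
        rw [List.mem_append, hW, List.mem_filter, decide_eq_true_eq]
        tauto
    · rcases List.mem_append.1 hS with h | h
      · refine ⟨fun h0 => ?_, (hmem S h).2.2.2.2⟩
        have := (hmem S h).2.1
        simp [h0] at this
      · exact h3 S h

theorem algorithmA1_val (t : ℕ) (L : List (List (Fin n))) :
    (Timed.algorithmA1 2 k t n L).val =
      (Timed.liftT L (Timed.phasesT 2 t L (k - 2) (List.finRange n)).val).val := by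
  simp [Timed.algorithmA1, Timed.val_bind, Timed.groundT]

/-- The length of the output list is compared with `D`, not with the returned family, since two
selected sets may be lifted to the same input set. -/
theorem isA1Output_algorithmA1 (hk : 2 ≤ k) (hI : I.IsEncodedBy L) {ε : ℝ} {r t : ℕ}
    (hr : 0 < r) (hε : 2 / (r : ℝ) ≤ ε) (ht : ∀ i ≤ k, 2 * i * tightBound i r + 2 ≤ t) :
    ∃ D, I.IsA1Output ε D (familyOf (Timed.algorithmA1 2 k t n L).val) ∧
      (Timed.algorithmA1 2 k t n L).val.length = D.card := by
  obtain ⟨h1, h2, h3⟩ := run_phasesT (t := t) hI hr hε (k - 2)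
    (fun i hi => ht i (by omega)) (List.finRange n) (List.nodup_finRange n)
  rw [algorithmA1_val, Timed.liftT_val]
  set R := (Timed.phasesT 2 t L (k - 2) (List.finRange n)).val
  obtain ⟨-, hd⟩ := List.nodup_flatten.1 (h2.nodup_iff.2 (List.nodup_finRange n))
  -- The lifting map feeds `S.toList` to the search, in an arbitrary order; the result is the one
  -- that the program found for `l`.
  have hcongr : ∀ l ∈ R, (Timed.containingT l.toFinset.toList L).val =
      (Timed.containingT l L).val := fun l hl =>
    (Timed.containingT_congr (fun x => by simp) (h3 l hl).2).symm
  refine ⟨familyOf R, ⟨?_, fun S => (Timed.containingT S.toList L).val.toFinset, ?_, ?_⟩, ?_⟩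
  · rw [Nat.add_sub_cancel' hk] at h1
    have : (List.finRange n).toFinset = Finset.univ := by
      ext x
      simp
    rwa [this] at h1
  · intro S hS
    obtain ⟨l, hl, rfl⟩ := mem_familyOf.1 hS
    have hex := (h3 l hl).2
    beta_reduce
    rw [hcongr l hl]
    obtain ⟨hT, hlT⟩ := Timed.containingT_val l L hex
    refine ⟨?_, fun x hx => List.mem_toFinset.2 (hlT (List.mem_toFinset.1 hx))⟩
    rw [← hI.2]
    exact mem_familyOf.2 ⟨_, hT, rfl⟩
  · ext S
    simp only [mem_familyOf, Finset.mem_image, List.mem_map]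
    constructor
    · rintro ⟨_, ⟨l, hl, rfl⟩, rfl⟩
      refine ⟨_, ⟨l, hl, rfl⟩, ?_⟩
      rw [hcongr l hl]
    · rintro ⟨_, ⟨l, hl, rfl⟩, rfl⟩
      refine ⟨_, ⟨l, hl, rfl⟩, ?_⟩
      rw [hcongr l hl]
  · rw [List.length_map, card_familyOf hd fun l hl => (h3 l hl).1]

end Execution

end UUSC

/-! ### Step counts -/

namespace Timed

section Steps

variable {α β : Type}

theorem appendT_steps (xs ys : List β) : (appendT xs ys).steps = xs.length + 1 := by
  induction xs with
  | nil => rfl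
  | cons x xs ih =>
    simp only [appendT, steps_bind, steps_pure, steps_tick, ih, List.length_cons]
    omega

theorem lengthT_steps (xs : List β) : (lengthT xs).steps = xs.length + 1 := by
  induction xs with
  | nil => rfl
  | cons x xs ih =>
    simp only [lengthT, steps_bind, steps_pure, steps_tick, ih, List.length_cons]
    omega

theorem flattenT_steps_le {b : ℕ} {xs : List (List β)} (h : ∀ l ∈ xs, l.length ≤ b) :
    (flattenT xs).steps ≤ xs.length * (b + 2) + 1 := by
  induction xs with
  | nil => simp [flattenT, steps_bind, steps_pure, steps_tick]
  | cons x xs ih =>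
    have h1 := ih fun l hl => h l (List.mem_cons_of_mem _ hl)
    have h2 := h x List.mem_cons_self
    simp only [flattenT, steps_bind, steps_tick, appendT_steps, List.length_cons]
    rw [Nat.succ_mul]
    omega

theorem consAllT_steps (x : β) (ls : List (List β)) :
    (consAllT x ls).steps = ls.length + 1 := by
  induction ls with
  | nil => rfl
  | cons l ls ih =>
    simp only [consAllT, steps_bind, steps_pure, steps_tick, ih, List.length_cons]
    omega

theorem length_sublistsT_val_le (i : ℕ) (l : List β) :
    (sublistsT i l).val.length ≤ (l.length + 1) ^ i := by
  induction l generalizing i with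
  | nil => cases i <;> simp [sublistsT, val_bind, val_pure]
  | cons x l ih =>
    cases i with
    | zero => simp [sublistsT, val_bind, val_pure]
    | succ i =>
      simp only [sublistsT, val_bind, appendT_val, consAllT_val, List.length_append,
        List.length_map, List.length_cons]
      have h1 := ih i
      have h2 := ih (i + 1)
      have h3 : (l.length + 1) ^ i ≤ (l.length + 1 + 1) ^ i := Nat.pow_le_pow_left (by omega) i
      rw [pow_succ] at h2 ⊢
      nlinarith

theorem sublistsT_steps_le (i : ℕ) (l : List β) :
    (sublistsT i l).steps ≤ 5 * (l.length + 1) ^ (i + 1) := by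
  induction l generalizing i with
  | nil => cases i <;> simp [sublistsT, steps_bind, steps_pure, steps_tick]
  | cons x l ih =>
    cases i with
    | zero =>
      simp [sublistsT, steps_bind, steps_pure, steps_tick]
      omega
    | succ i =>
      simp only [sublistsT, steps_bind, steps_tick, appendT_steps, consAllT_steps, consAllT_val,
        List.length_map, List.length_cons]
      have h0 := length_sublistsT_val_le i l
      have h1 := ih i
      have h2 := ih (i + 1)
      have h3 : (l.length + 1) ^ i ≤ (l.length + 1 + 1) ^ i := Nat.pow_le_pow_left (by omega) i
      have h4 : 1 ≤ (l.length + 1) ^ i := Nat.one_le_pow _ _ (by omega)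
      have h5 := Nat.mul_le_mul_left ((l.length + 1 + 1) ^ 2) h3
      have e1 : (l.length + 1) ^ (i + 1) = (l.length + 1) * (l.length + 1) ^ i := by ring
      have e2 : (l.length + 1) ^ (i + 1 + 1) =
          (l.length + 1) * ((l.length + 1) * (l.length + 1) ^ i) := by ring
      have e3 : (l.length + 1 + 1) ^ (i + 1 + 1) =
          (l.length + 1 + 1) ^ 2 * (l.length + 1 + 1) ^ i := by ring
      rw [e1] at h1
      rw [e2] at h2
      rw [e3]
      generalize (l.length + 1) ^ i = y at *
      generalize (l.length + 1 + 1) ^ i = z at *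
      nlinarith

theorem length_sublistsUpToT_val_le (t : ℕ) (l : List β) :
    (sublistsUpToT t l).val.length ≤ (t + 1) * (l.length + 1) ^ t := by
  induction t with
  | zero =>
    simpa [sublistsUpToT, val_bind] using length_sublistsT_val_le 0 l
  | succ t ih =>
    simp only [sublistsUpToT, val_bind, appendT_val, List.length_append]
    have h1 := length_sublistsT_val_le (t + 1) l
    have h2 : (l.length + 1) ^ t ≤ (l.length + 1) ^ (t + 1) :=
      Nat.pow_le_pow_right (by omega) (Nat.le_succ t)
    nlinarith

/-- Of the factor `8`, enumerating one length takes `5`; the rest pays for the tick and for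
appending. -/
theorem sublistsUpToT_steps_le (t : ℕ) (l : List β) :
    (sublistsUpToT t l).steps ≤ (t + 1) * (8 * (l.length + 1) ^ (t + 1)) := by
  induction t with
  | zero =>
    have := sublistsT_steps_le 0 l
    simp only [sublistsUpToT, steps_bind, steps_tick]
    simp only [zero_add, pow_one] at this ⊢
    omega
  | succ t ih =>
    simp only [sublistsUpToT, steps_bind, steps_tick, appendT_steps]
    have h0 := length_sublistsT_val_le (t + 1) l
    have h1 := sublistsT_steps_le (t + 1) l
    have h2 : (l.length + 1) ^ (t + 1) ≤ (l.length + 1) ^ (t + 1 + 1) :=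
      Nat.pow_le_pow_right (by omega) (Nat.le_succ _)
    have h3 : 1 ≤ (l.length + 1) ^ (t + 1) := Nat.one_le_pow _ _ (by omega)
    generalize (l.length + 1) ^ (t + 1) = y at *
    generalize (l.length + 1) ^ (t + 1 + 1) = z at *
    nlinarith

theorem blocksT_steps (p : ℕ) (B : List β) (r : ℕ) (V : List β) :
    (blocksT p B r V).steps = V.length + 1 := by
  induction V generalizing B r with
  | nil => cases B <;> rfl
  | cons x V ih =>
    cases r <;>
    · simp only [blocksT, steps_bind, steps_pure, steps_tick, ih, List.length_cons]
      omega

variable [DecidableEq α]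

theorem memT_steps_le (x : α) (l : List α) : (memT x l).steps ≤ l.length + 1 := by
  induction l with
  | nil => simp [memT, steps_bind, steps_pure, steps_tick]
  | cons y l ih =>
    simp only [memT, steps_bind, steps_tick, steps_ite, steps_pure, List.length_cons]
    split_ifs <;> omega

theorem subsetT_steps_le (xs ys : List α) :
    (subsetT xs ys).steps ≤ xs.length * (ys.length + 2) + 1 := by
  induction xs with
  | nil => simp [subsetT, steps_bind, steps_pure, steps_tick]
  | cons x xs ih =>
    have := memT_steps_le x ys
    simp only [subsetT, steps_bind, steps_tick, steps_ite, steps_pure, List.length_cons]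
    rw [Nat.succ_mul]
    split_ifs <;> omega

theorem disjointT_steps_le (xs ys : List α) :
    (disjointT xs ys).steps ≤ xs.length * (ys.length + 2) + 1 := by
  induction xs with
  | nil => simp [disjointT, steps_bind, steps_pure, steps_tick]
  | cons x xs ih =>
    have := memT_steps_le x ys
    simp only [disjointT, steps_bind, steps_tick, steps_ite, steps_pure, List.length_cons]
    rw [Nat.succ_mul]
    split_ifs <;> omega

theorem interT_steps_le (xs ys : List α) :
    (interT xs ys).steps ≤ xs.length * (ys.length + 2) + 1 := by
  induction xs with
  | nil => simp [interT, steps_bind, steps_pure, steps_tick]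
  | cons x xs ih =>
    have := memT_steps_le x ys
    simp only [interT, steps_bind, steps_tick, steps_ite, steps_pure, List.length_cons]
    rw [Nat.succ_mul]
    split_ifs <;> omega

theorem diffT_steps_le (xs ys : List α) :
    (diffT xs ys).steps ≤ xs.length * (ys.length + 2) + 1 := by
  induction xs with
  | nil => simp [diffT, steps_bind, steps_pure, steps_tick]
  | cons x xs ih =>
    have := memT_steps_le x ys
    simp only [diffT, steps_bind, steps_tick, steps_ite, steps_pure, List.length_cons]
    rw [Nat.succ_mul]
    split_ifs <;> omega

theorem mul_add_two_le {a b c : ℕ} (ha : a ≤ c) (hb : b ≤ c) : a * (b + 2) ≤ c * (c + 2) :=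
  Nat.mul_le_mul ha (by omega)

theorem disjointAllT_steps_le {b : ℕ} {S : List α} {Ts : List (List α)} (hS : S.length ≤ b)
    (h : ∀ T ∈ Ts, T.length ≤ b) :
    (disjointAllT S Ts).steps ≤ Ts.length * (b * (b + 2) + 2) + 1 := by
  induction Ts with
  | nil => simp [disjointAllT, steps_bind, steps_pure, steps_tick]
  | cons T Ts ih =>
    have h1 := ih fun l hl => h l (List.mem_cons_of_mem _ hl)
    have h2 := disjointT_steps_le S T
    have h3 := mul_add_two_le hS (h T List.mem_cons_self)
    simp only [disjointAllT, steps_bind, steps_tick, steps_ite, steps_pure, List.length_cons]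
    rw [Nat.succ_mul]
    split_ifs <;> omega

theorem pairwiseDisjointT_steps_le {b t : ℕ} {Ts : List (List α)} (ht : Ts.length ≤ t)
    (h : ∀ T ∈ Ts, T.length ≤ b) :
    (pairwiseDisjointT Ts).steps ≤ Ts.length * (t * (b * (b + 2) + 2) + 2) + 1 := by
  induction Ts with
  | nil => simp [pairwiseDisjointT, steps_bind, steps_pure, steps_tick]
  | cons T Ts ih =>
    have h0 : ∀ l ∈ Ts, l.length ≤ b := fun l hl => h l (List.mem_cons_of_mem _ hl)
    rw [List.length_cons] at ht
    have h1 := ih (by omega) h0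
    have h2 := disjointAllT_steps_le (h T List.mem_cons_self) h0
    have h3 := Nat.mul_le_mul_right (b * (b + 2) + 2) (by omega : Ts.length ≤ t)
    simp only [pairwiseDisjointT, steps_bind, steps_tick, steps_ite, steps_pure, List.length_cons]
    rw [Nat.succ_mul]
    split_ifs <;> omega

theorem keepT_steps_le {b t : ℕ} {Q P : List (List α)} (hQt : Q.length ≤ t)
    (hQ : ∀ T ∈ Q, T.length ≤ b) (hP : ∀ T ∈ P, T.length ≤ b) :
    (keepT Q P).steps ≤ P.length * (t * (b * (b + 2) + 2) + 2) + 1 := by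
  induction P with
  | nil => simp [keepT, steps_bind, steps_pure, steps_tick]
  | cons S P ih =>
    have h1 := ih fun l hl => hP l (List.mem_cons_of_mem _ hl)
    have h2 := disjointAllT_steps_le (hP S List.mem_cons_self) hQ
    have h3 := Nat.mul_le_mul_right (b * (b + 2) + 2) hQt
    simp only [keepT, steps_bind, steps_tick, steps_ite, steps_pure, List.length_cons]
    rw [Nat.succ_mul]
    split_ifs <;> omega

/-- Each input set contributes at most `(b + 1) ^ b` sublists, a constant for bounded set size, so
the number of candidates is linear in the length of `L`. -/
theorem length_freeSetsT_val_le {b i : ℕ} {V : List α} {L : List (List α)} (hi : i ≤ b)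
    (hL : ∀ S ∈ L, S.length ≤ b) :
    (freeSetsT V i L).val.length ≤ L.length * (b + 1) ^ b := by
  induction L with
  | nil => simp [freeSetsT, val_bind, val_pure]
  | cons S L ih =>
    have h1 := ih fun l hl => hL l (List.mem_cons_of_mem _ hl)
    have h2 := length_sublistsT_val_le i (S.filter fun x => x ∈ V)
    have h3 : ((S.filter fun x => x ∈ V).length + 1) ^ i ≤ (b + 1) ^ b :=
      (Nat.pow_le_pow_left (Nat.succ_le_succ ((List.length_filter_le _ _).trans
        (hL S List.mem_cons_self))) i).trans (Nat.pow_le_pow_right (by omega) hi)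
    simp only [freeSetsT, val_bind, appendT_val, interT_val, List.length_append, List.length_cons]
    rw [Nat.succ_mul]
    omega

theorem freeSetsT_steps_le {b i : ℕ} {V : List α} {L : List (List α)} (hi : i ≤ b)
    (hL : ∀ S ∈ L, S.length ≤ b) :
    (freeSetsT V i L).steps ≤
      L.length * (b * (V.length + 2) + 5 * (b + 1) ^ (b + 1) + (b + 1) ^ b + 3) + 1 := by
  induction L with
  | nil => simp [freeSetsT, steps_bind, steps_pure, steps_tick]
  | cons S L ih =>
    have h1 := ih fun l hl => hL l (List.mem_cons_of_mem _ hl)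
    have h2 := length_sublistsT_val_le i (S.filter fun x => x ∈ V)
    have h4 := sublistsT_steps_le i (S.filter fun x => x ∈ V)
    have h0 : (S.filter fun x => x ∈ V).length + 1 ≤ b + 1 :=
      Nat.succ_le_succ ((List.length_filter_le _ _).trans (hL S List.mem_cons_self))
    have h3 : ((S.filter fun x => x ∈ V).length + 1) ^ i ≤ (b + 1) ^ b :=
      (Nat.pow_le_pow_left h0 i).trans (Nat.pow_le_pow_right (by omega) hi)
    have h5 : ((S.filter fun x => x ∈ V).length + 1) ^ (i + 1) ≤ (b + 1) ^ (b + 1) :=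
      (Nat.pow_le_pow_left h0 _).trans (Nat.pow_le_pow_right (by omega) (by omega))
    have h6 := interT_steps_le S V
    have h7 := Nat.mul_le_mul_right (V.length + 2) (hL S List.mem_cons_self)
    simp only [freeSetsT, steps_bind, steps_tick, interT_val, appendT_steps, List.length_cons]
    rw [Nat.succ_mul]
    omega

theorem improveT_steps_le {b t p : ℕ} {P : List (List α)} {Qs : List (List (List α))}
    (hQt : ∀ Q ∈ Qs, Q.length ≤ t) (hQ : ∀ Q ∈ Qs, ∀ T ∈ Q, T.length ≤ b)
    (hP : ∀ T ∈ P, T.length ≤ b) (hp : P.length ≤ p) :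
    (improveT P Qs).steps ≤
      Qs.length * ((t + p) * (t * (b * (b + 2) + 2) + 4) + 6) + 1 := by
  induction Qs with
  | nil => simp [improveT, steps_bind, steps_pure, steps_tick]
  | cons Q Qs ih =>
    have h1 := ih (fun l hl => hQt l (List.mem_cons_of_mem _ hl))
      (fun l hl => hQ l (List.mem_cons_of_mem _ hl))
    have hq := hQt Q List.mem_cons_self
    have h2 := pairwiseDisjointT_steps_le hq (hQ Q List.mem_cons_self)
    have h3 := keepT_steps_le hq (hQ Q List.mem_cons_self) hP
    have h4 : (keepT Q P).val.length ≤ P.length := by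
      rw [keepT_val]
      exact List.length_filter_le _ _
    have h5 := Nat.mul_le_mul_right (t * (b * (b + 2) + 2) + 2) hq
    have h6 := Nat.mul_le_mul_right (t * (b * (b + 2) + 2) + 2) hp
    -- The summands pay for the disjointness test, for `keepT`, and for one append and two length
    -- computations; the constant `6` collects the tick and the `+ 1` of these five calls.
    have h7 : (t + p) * (t * (b * (b + 2) + 2) + 4) =
        t * (t * (b * (b + 2) + 2) + 2) + p * (t * (b * (b + 2) + 2) + 2) + 2 * t + 2 * p := by
      ring
    simp only [improveT, steps_bind, steps_tick, steps_ite, steps_pure, appendT_steps,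
      appendT_val, lengthT_steps, lengthT_val, List.length_cons, List.length_append]
    rw [Nat.succ_mul]
    split_ifs <;> omega

/-- A round adds at most `t` sets, so `p` bounds the length of every intermediate packing. This
crude bound spares an appeal to disjointness. -/
theorem localSearchT_steps_le {b t p : ℕ} {Qs : List (List (List α))}
    (hQt : ∀ Q ∈ Qs, Q.length ≤ t) (hQ : ∀ Q ∈ Qs, ∀ T ∈ Q, T.length ≤ b)
    (m : ℕ) (P : List (List α)) (hP : ∀ T ∈ P, T.length ≤ b) (hp : P.length + m * t ≤ p) :
    (localSearchT Qs m P).steps ≤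
      m * (Qs.length * ((t + p) * (t * (b * (b + 2) + 2) + 4) + 6) + 2) + 1 := by
  induction m generalizing P with
  | zero => simp [localSearchT, steps_bind, steps_pure, steps_tick]
  | succ m ih =>
    rw [Nat.succ_mul] at hp ⊢
    have h1 := improveT_steps_le (p := p) hQt hQ hP (by omega)
    simp only [localSearchT, steps_bind, steps_tick]
    cases h : (improveT P Qs).val with
    | none =>
      simp only [steps_pure]
      omega
    | some P' =>
      obtain ⟨Q, hQQ, -, rfl, -⟩ := improveT_val_eq_some h
      have hq := hQt Q hQQ
      rw [keepT_val]
      have h2 := List.length_filter_le (fun S => (disjointAllT S Q).val) P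
      have h3 := ih (Q ++ P.filter fun S => (disjointAllT S Q).val) (fun T hT => by
        rcases List.mem_append.1 hT with h | h
        · exact hQ Q hQQ T h
        · exact hP T (List.mem_filter.1 h).1) (by rw [List.length_append]; omega)
      simp only
      omega

/-- A bound for the number of steps of a packing phase. -/
def packBound (b t N : ℕ) : ℕ :=
  N * (b * (N + 2) + 5 * (b + 1) ^ (b + 1) + (b + 1) ^ b + 3) +
    (t + 1) * (8 * (N * (b + 1) ^ b + 1) ^ (t + 1)) + N +
    N * ((t + 1) * (N * (b + 1) ^ b + 1) ^ t *
      ((t + N * t) * (t * (b * (b + 2) + 2) + 4) + 6) + 2) + 4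

theorem packT_steps_le {b t i N : ℕ} {V : List α} {L : List (List α)} (hi : i ≤ b)
    (hL : ∀ S ∈ L, S.length ≤ b) (hLN : L.length ≤ N) (hVN : V.length ≤ N) :
    (packT t L V i).steps ≤ packBound b t N := by
  have h1 := freeSetsT_steps_le (V := V) hi hL
  have h2 := length_freeSetsT_val_le (V := V) hi hL
  have h3 := sublistsUpToT_steps_le t (freeSetsT V i L).val
  have h4 := length_sublistsUpToT_val_le t (freeSetsT V i L).val
  have hC : ∀ l ∈ (freeSetsT V i L).val, l.length ≤ b := fun l hl => by
    obtain ⟨S, -, -, h⟩ := (mem_freeSetsT_val _ _ _ _).1 hl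
    omega
  have h5 := localSearchT_steps_le (b := b) (t := t) (p := N * t)
    (Qs := (sublistsUpToT t (freeSetsT V i L).val).val)
    (fun Q hQ => ((mem_sublistsUpToT_val _ _ _).1 hQ).2)
    (fun Q hQ T hT => hC T (((mem_sublistsUpToT_val _ _ _).1 hQ).1.subset hT))
    V.length [] (by simp) (by simpa using Nat.mul_le_mul_right t hVN)
  have hC' : (freeSetsT V i L).val.length + 1 ≤ N * (b + 1) ^ b + 1 :=
    Nat.succ_le_succ (h2.trans (Nat.mul_le_mul_right _ hLN))
  have g1 : L.length * (b * (V.length + 2) + 5 * (b + 1) ^ (b + 1) + (b + 1) ^ b + 3) ≤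
      N * (b * (N + 2) + 5 * (b + 1) ^ (b + 1) + (b + 1) ^ b + 3) := by gcongr
  have g2 : (t + 1) * (8 * ((freeSetsT V i L).val.length + 1) ^ (t + 1)) ≤
      (t + 1) * (8 * (N * (b + 1) ^ b + 1) ^ (t + 1)) := by gcongr
  have g3 : (sublistsUpToT t (freeSetsT V i L).val).val.length ≤
      (t + 1) * (N * (b + 1) ^ b + 1) ^ t := h4.trans (by gcongr)
  have g4 := Nat.mul_le_mul hVN (Nat.add_le_add_right (Nat.mul_le_mul_right
    ((t + N * t) * (t * (b * (b + 2) + 2) + 4) + 6) g3) 2)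
  simp only [packT, steps_bind, steps_tick, lengthT_steps, lengthT_val, packBound]
  omega

theorem containingT_steps_le {b : ℕ} {S : List α} {L : List (List α)} (hS : S.length ≤ b)
    (h : ∀ T ∈ L, T.length ≤ b) :
    (containingT S L).steps ≤ L.length * (b * (b + 2) + 2) + 1 := by
  induction L with
  | nil => simp [containingT, steps_bind, steps_pure, steps_tick]
  | cons T Ts ih =>
    have h1 := ih fun l hl => h l (List.mem_cons_of_mem _ hl)
    have h2 := subsetT_steps_le S T
    have h3 := mul_add_two_le hS (h T List.mem_cons_self)
    simp only [containingT, steps_bind, steps_tick, steps_ite, steps_pure, List.length_cons]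
    rw [Nat.succ_mul]
    split_ifs <;> omega

theorem liftT_steps_le {b : ℕ} {L Ss : List (List α)} (hS : ∀ S ∈ Ss, S.length ≤ b)
    (h : ∀ T ∈ L, T.length ≤ b) :
    (liftT L Ss).steps ≤ Ss.length * (L.length * (b * (b + 2) + 2) + 2) + 1 := by
  induction Ss with
  | nil => simp [liftT, steps_bind, steps_pure, steps_tick]
  | cons S Ss ih =>
    have h1 := ih fun l hl => hS l (List.mem_cons_of_mem _ hl)
    have h2 := containingT_steps_le (hS S List.mem_cons_self) h
    simp only [liftT, steps_bind, steps_tick, steps_pure, List.length_cons]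
    rw [Nat.succ_mul]
    omega

theorem phasesT_steps_le {b t N p : ℕ} {L : List (List α)} (d : ℕ) {V : List α}
    (hd : p + d ≤ b) (hL : ∀ S ∈ L, S.Nodup ∧ S.length ≤ b) (hLN : L.length ≤ N)
    (hVN : V.length ≤ N) :
    (phasesT p t L d V).steps ≤
      d * (packBound b t N + N * (b + 2) + N * (N * b + 2) + N + 4) + N + 2 := by
  induction d generalizing V with
  | zero =>
    simp only [phasesT, steps_bind, steps_tick, blocksT_steps]
    omega
  | succ d ih =>
    have h1 := packT_steps_le (t := t) (V := V) (by omega : p + d + 1 ≤ b)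
      (fun S hS => (hL S hS).2) hLN hVN
    obtain ⟨hP, -⟩ := packT_val (t := t) (V := V) (L := L) (fun S hS => (hL S hS).1)
      (by omega : 0 < p + d + 1)
    simp only [phasesT, steps_bind, steps_tick, appendT_steps, flattenT_val, diffT_val]
    have hmem : ∀ l ∈ (packT t L V (p + d + 1)).val,
        l.length = p + d + 1 ∧ l.Nodup ∧ l ⊆ V := fun l hl => by
      obtain ⟨S, hS, h, h'⟩ := (mem_freeSetsT_val _ _ _ _).1 (hP.1 l hl)
      refine ⟨h', ((hL S hS).1.filter _).sublist h, fun x hx => ?_⟩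
      simpa using (List.mem_filter.1 (h.subset hx)).2
    have hPV := length_le_of_pairwise_disjoint hP.2 fun l hl => by
      obtain ⟨h2, h3⟩ := hmem l hl
      exact ⟨fun h0 => by simp [h0] at h2, h3⟩
    set P := (packT t L V (p + d + 1)).val
    have h2 := flattenT_steps_le (b := b) (xs := P) fun l hl => by
      have := (hmem l hl).1
      omega
    have h3 := Nat.mul_le_mul_right (b + 2) (hPV.trans hVN)
    have h4 := diffT_steps_le V P.flatten
    have h5 : P.flatten.length ≤ P.length * b := by
      rw [List.length_flatten]
      refine (List.sum_le_card_nsmul _ b fun x hx => ?_).trans (by simp)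
      obtain ⟨l, hl, rfl⟩ := List.mem_map.1 hx
      have := (hmem l hl).1
      omega
    have h6 : V.length * (P.flatten.length + 2) ≤ N * (N * b + 2) :=
      Nat.mul_le_mul hVN (Nat.add_le_add_right
        (h5.trans (Nat.mul_le_mul_right b (hPV.trans hVN))) 2)
    have h7 := ih (V := V.filter fun x => x ∉ P.flatten) (by omega)
      ((List.length_filter_le _ _).trans hVN)
    rw [Nat.succ_mul]
    omega

end Steps

/-- A bound for the number of steps of algorithm A1. -/
def algorithmBound (k t N : ℕ) : ℕ :=
  k * (packBound k t N + N * (k + 2) + N * (N * k + 2) + N + 4) + N + 2 +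
    N * (N * (k * (k + 2) + 2) + 2) + N + 3

end Timed

/-! ### Polynomial bound in the input size and conclusion -/

theorem length_le_inputSize {n : ℕ} (L : List (List (Fin n))) :
    L.length ≤ inputSize n L ∧ n ≤ inputSize n L := by
  refine ⟨?_, Nat.le_add_right _ _⟩
  refine le_trans ?_ (Nat.le_add_left _ _)
  induction L with
  | nil => simp
  | cons S L ih =>
    simp only [List.length_cons, List.map_cons, List.sum_cons]
    omega

theorem UUSC.IsEncodedBy.algorithmA1_steps_le {k n : ℕ} {I : UUSC 2 k n} (hk : 2 ≤ k)
    {L : List (List (Fin n))} (hI : I.IsEncodedBy L) {r t : ℕ} (hr : 0 < r)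
    (ht : ∀ i ≤ k, 2 * i * tightBound i r + 2 ≤ t) :
    (Timed.algorithmA1 2 k t n L).steps ≤ Timed.algorithmBound k t (inputSize n L) := by
  obtain ⟨hLN, hnN⟩ := length_le_inputSize L
  set N := inputSize n L
  -- Only the partition and containment statements matter here, so the accuracy is taken to be `2 /
  -- r` itself.
  obtain ⟨-, h2, h3⟩ := run_phasesT (t := t) hI hr le_rfl (k - 2)
    (fun i hi => ht i (by omega)) (List.finRange n) (List.nodup_finRange n)
  have hL : ∀ S ∈ L, S.length ≤ k := fun S hS => hI.length_le hS
  have h4 := Timed.phasesT_steps_le (t := t) (N := N) (p := 2) (k - 2) (V := List.finRange n)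
    (by omega : 2 + (k - 2) ≤ k) (fun S hS => ⟨hI.1 S hS, hL S hS⟩) hLN (by simpa using hnN)
  simp only [Timed.algorithmA1, Timed.steps_bind, Timed.steps_tick, Timed.groundT]
  set R := (Timed.phasesT 2 t L (k - 2) (List.finRange n)).val
  obtain ⟨hn, hd⟩ := List.nodup_flatten.1 (h2.nodup_iff.2 (List.nodup_finRange n))
  have h5 := length_le_of_pairwise_disjoint hd (V := List.finRange n)
    fun l hl => ⟨(h3 l hl).1, hn l hl, fun x _ => List.mem_finRange x⟩
  rw [List.length_finRange] at h5
  have h6 := Timed.liftT_steps_le (b := k) (L := L) (Ss := R) (fun l hl => by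
    obtain ⟨T, hT, hlT⟩ := (h3 l hl).2
    exact ((hn l hl).subperm hlT).length_le.trans (hL T hT)) hL
  have h7 : R.length * (L.length * (k * (k + 2) + 2) + 2) ≤ N * (N * (k * (k + 2) + 2) + 2) := by
    have := h5.trans hnN
    gcongr
  have h8 := Nat.mul_le_mul_right
    (Timed.packBound k t N + N * (k + 2) + N * (N * k + 2) + N + 4) (Nat.sub_le k 2)
  simp only [Timed.algorithmBound]
  omega

/-- The bound is built from constants and `N` by sums, products and powers, and its exponents
involve only `k` and `t`. -/
theorem exists_polynomial_eval_algorithmBound (k t : ℕ) :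
    ∃ q : Polynomial ℕ, ∀ N, q.eval N = Timed.algorithmBound k t N := by
  let IsPoly : (ℕ → ℕ) → Prop := fun f => ∃ q : Polynomial ℕ, ∀ N, q.eval N = f N
  have hc : ∀ c, IsPoly fun _ => c := fun c => ⟨Polynomial.C c, fun N => by simp⟩
  have hid : IsPoly fun N => N := ⟨Polynomial.X, fun N => by simp⟩
  have hadd : ∀ {f g}, IsPoly f → IsPoly g → IsPoly fun N => f N + g N := by
    rintro f g ⟨p, hp⟩ ⟨q, hq⟩
    exact ⟨p + q, fun N => by simp [hp, hq]⟩
  have hmul : ∀ {f g}, IsPoly f → IsPoly g → IsPoly fun N => f N * g N := by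
    rintro f g ⟨p, hp⟩ ⟨q, hq⟩
    exact ⟨p * q, fun N => by simp [hp, hq]⟩
  have hpow : ∀ {f} (e : ℕ), IsPoly f → IsPoly fun N => f N ^ e := by
    rintro f e ⟨p, hp⟩
    exact ⟨p ^ e, fun N => by simp [hp]⟩
  change IsPoly fun N => Timed.algorithmBound k t N
  unfold Timed.algorithmBound Timed.packBound
  repeat' first
    | exact hc _
    | exact hid
    | apply hadd
    | apply hmul
    | apply hpow

theorem mainTheorem3 (ε : ℝ) (hε : 0 < ε) :
    (∀ (n : ℕ) (I : UUSC 2 4 n) (D APX : Finset (Finset (Fin n))), I.IsA1Output ε D APX →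
      I.IsCover APX ∧ APX.card ≤ D.card ∧ (D.card : ℝ) ≤ (3 / 2 + ε) * (I.opt : ℝ) + 1) ∧
    ∃ (t : ℕ) (q : Polynomial ℕ),
      ∀ (n : ℕ) (I : UUSC 2 4 n) (L : List (List (Fin n))), I.IsEncodedBy L →
        (Timed.algorithmA1 2 4 t n L).steps ≤ q.eval (inputSize n L) ∧
        (∃ D, I.IsA1Output ε D (familyOf (Timed.algorithmA1 2 4 t n L).val) ∧
          (Timed.algorithmA1 2 4 t n L).val.length = D.card) ∧
        I.IsCover (familyOf (Timed.algorithmA1 2 4 t n L).val) ∧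
        ((Timed.algorithmA1 2 4 t n L).val.length : ℝ) ≤ (3 / 2 + ε) * (I.opt : ℝ) + 1 := by
  refine ⟨fun n I D APX h => ⟨h.isCover, h.card_le, h.1.card_le_opt hε.le⟩, ?_⟩
  -- With `r = m + 1` layers the loss `2 / r` is at most `ε`; the added `1` makes `r` visibly
  -- positive.
  obtain ⟨m, hm⟩ := exists_nat_ge (2 / ε)
  have hr : 0 < m + 1 := Nat.succ_pos m
  have hrε : 2 / ((m + 1 : ℕ) : ℝ) ≤ ε := by
    rw [div_le_iff₀ hε] at hm
    rw [div_le_iff₀ (by positivity)]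
    push_cast
    nlinarith
  -- One `t` that is large enough for local search with every set size up to `4`; it depends on `ε`
  -- only through `m`.
  let t := (Finset.range 5).sup fun i => 2 * i * tightBound i (m + 1) + 2
  have ht : ∀ i ≤ 4, 2 * i * tightBound i (m + 1) + 2 ≤ t := fun i hi =>
    Finset.le_sup (f := fun i => 2 * i * tightBound i (m + 1) + 2)
      (Finset.mem_range.2 (Nat.lt_succ_of_le hi))
  obtain ⟨q, hq⟩ := exists_polynomial_eval_algorithmBound 4 t
  refine ⟨t, q, fun n I L hI => ?_⟩
  obtain ⟨D, hD, hlen⟩ := UUSC.isA1Output_algorithmA1 (by norm_num) hI hr hrε ht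
  refine ⟨?_, ⟨D, hD, hlen⟩, hD.isCover, ?_⟩
  · rw [hq]
    exact hI.algorithmA1_steps_le (by norm_num) hr ht
  · rw [hlen]
    exact hD.1.card_le_opt hε.le
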